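/- For $f:\mathbb Z\to\mathbb C$ and $h\in\mathbb Z$ write $\Delta_hf(x)=f(x)\overline{f(x+h)}$ and $\Delta_{h_1,\dots,h_s}f=\Delta_{h_1}\cdots\Delta_{h_s}f$. For finitely supported $f$ and $s\ge 1$ the unnormalised Gowers norm $\|f\|_{U^s}\ge 0$ is defined by $$\|f\|_{U^s}^{2^s}=\sum_{x,h_1,\dots,h_s\in\mathbb Z}\Delta_{h_1,\dots,h_s}f(x).$$ For a positive integer $N$ and $f_0,f_1:\mathbb Z\to\mathbb C$ define the dual function $$\tilde A_N^{**}(f_0,f_1)(x)=\frac1N\sum_{n=1}^N 1_{n>N/2}\,f_0(x+n)\,f_1(x-\lfloor\sqrt n\rfloor+n)\qquad(x\in\mathbb Z).$$ **Theorem (Degree Lowering).** Let $K\ge 1$. There are constants $C,A>0$ depending only on $K$ and, for each integer $s\ge 3$, constants $c_s,B_s>0$ depending only on $s$ and $K$, such that the following holds for every integer $s\ge 3$. Let $N\ge 1$ be an integer, let $0<\delta\le 1$, let $N_0$ be a real number with $N/K\le N_0\le KN$, and let $f_0,f_1:\mathbb Z\to\mathbb C$ be functions with $|f_0|,|f_1|\le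 1$, supported on the integers of $[-N_0,N_0]$. If $$\|\tilde A_N^{**}(f_0,f_1)\|_{U^s}^{2^s}\ge\delta N^{s+1},$$ then either $N\le C\delta^{-A}$ or $$\|\tilde A_N^{**}(f_0,f_1)\|_{U^{s-1}}^{2^{s-1}}\ge c_s\,\delta^{B_s}N^s.$$ -/

import Mathlib

open scoped ComplexConjugate

/-- The differencing operator `Δ_h f (x) = f(x) * conj (f (x + h))` on functions `ℤ → ℂ`. -/
def diffOp (h : ℤ) (f : ℤ → ℂ) : ℤ → ℂ :=
  fun x => f x * conj (f (x + h))

/-- The iterated differencing operator `Δ_{h_1, …, h_s} f = Δ_{h_1} ⋯ Δ_{h_s} f`. -/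
def iterDiff : (s : ℕ) → (Fin s → ℤ) → (ℤ → ℂ) → ℤ → ℂ
  | 0, _, f => f
  | s + 1, h, f => diffOp (h 0) (iterDiff s (Fin.tail h) f)

/-- The sum `∑_{x, h_1, …, h_s ∈ ℤ} Δ_{h_1, …, h_s} f (x)`; it has finitely many nonzero terms
when `f` is finitely supported and `s ≥ 1`. -/
noncomputable def gowersSum (s : ℕ) (f : ℤ → ℂ) : ℂ :=
  ∑' p : ℤ × (Fin s → ℤ), iterDiff s p.2 f p.1

/-- The unnormalised Gowers norm `‖f‖_{U^s(ℤ)}` of a finitely supported function, for `s ≥ 1`: the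
`2^s`-th root of the sum `gowersSum s f`. That sum is then a nonnegative real number, so it equals
its modulus; see `gowersNorm_pow_eq` below. -/
noncomputable def gowersNorm (s : ℕ) (f : ℤ → ℂ) : ℝ :=
  ‖gowersSum s f‖ ^ (((2 : ℝ) ^ s)⁻¹)

/-- The dual function
`(1/N) ∑_{n=1}^N 1_{n > N/2} f₀(x + n) f₁(x - ⌊√n⌋ + n)`. -/
noncomputable def dualFun (N : ℕ) (f₀ f₁ : ℤ → ℂ) : ℤ → ℂ :=
  fun x => (1 / (N : ℂ)) * ∑ n ∈ Finset.Icc 1 N,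
    if (N : ℝ) / 2 < (n : ℝ) then f₀ (x + n) * f₁ (x - ⌊Real.sqrt (n : ℝ)⌋ + n) else 0

theorem iterDiff_support (f : ℤ → ℂ) : ∀ (s : ℕ) (h : Fin s → ℤ) (x : ℤ),
    iterDiff s h f x ≠ 0 → f x ≠ 0 ∧ ∀ i, f (x + h i) ≠ 0
  | 0, _, _, hx => ⟨hx, fun i => i.elim0⟩
  | s + 1, h, x, hx => by
    have h1 : iterDiff s (Fin.tail h) f x ≠ 0 := left_ne_zero_of_mul hx
    have h2 : iterDiff s (Fin.tail h) f (x + h 0) ≠ 0 := fun h0 =>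
      hx (by simp [iterDiff, diffOp, h0])
    refine ⟨(iterDiff_support f s _ _ h1).1, fun i => ?_⟩
    refine Fin.cases ?_ (fun j => ?_) i
    · exact (iterDiff_support f s _ _ h2).1
    · exact (iterDiff_support f s _ _ h1).2 j

theorem iterDiff_finite {f : ℤ → ℂ} (hf : f.support.Finite) (s : ℕ) :
    (Function.support fun p : ℤ × (Fin s → ℤ) => iterDiff s p.2 f p.1).Finite := by
  have hD : (Set.image2 (fun y x : ℤ => y - x) f.support f.support).Finite := hf.image2 _ hf
  refine (hf.prod (Set.Finite.pi' fun _ : Fin s => hD)).subset ?_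
  rintro ⟨x, h⟩ hx
  obtain ⟨h1, h2⟩ := iterDiff_support f s h x hx
  exact ⟨h1, fun i => ⟨_, h2 i, _, h1, by simp⟩⟩

theorem gowersSum_succ {f : ℤ → ℂ} (hf : f.support.Finite) (s : ℕ) :
    gowersSum (s + 1) f = ((∑' h : Fin s → ℤ, ‖∑' x, iterDiff s h f x‖ ^ 2 : ℝ) : ℂ) := by
  have hfin : ∀ h : Fin s → ℤ, (Function.support (iterDiff s h f)).Finite := fun h =>
    hf.subset fun x hx => (iterDiff_support f s h x hx).1
  have hsum : ∀ h : Fin s → ℤ, Summable (iterDiff s h f) := fun h =>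
    summable_of_hasFiniteSupport (hfin h)
  let e : (Fin s → ℤ) × (ℤ × ℤ) ≃ ℤ × (Fin (s + 1) → ℤ) :=
    { toFun := fun q => (q.2.1, Fin.cons (q.2.2 - q.2.1) q.1)
      invFun := fun p => (Fin.tail p.2, (p.1, p.1 + p.2 0))
      left_inv := fun q => by simp
      right_inv := fun p => by simp }
  have hs : Summable fun q : (Fin s → ℤ) × (ℤ × ℤ) =>
      iterDiff s q.1 f q.2.1 * conj (iterDiff s q.1 f q.2.2) := by
    have := (e.summable_iff (f := fun p : ℤ × (Fin (s + 1) → ℤ) =>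
      iterDiff (s + 1) p.2 f p.1)).2 (summable_of_hasFiniteSupport (iterDiff_finite hf (s + 1)))
    refine this.congr fun q => ?_
    simp [e, iterDiff, diffOp]
  have hE : gowersSum (s + 1) f = ∑' q : (Fin s → ℤ) × (ℤ × ℤ),
      iterDiff s q.1 f q.2.1 * conj (iterDiff s q.1 f q.2.2) := by
    rw [gowersSum, ← e.tsum_eq]
    refine tsum_congr fun q => ?_
    simp [e, iterDiff, diffOp]
  rw [hE, hs.tsum_prod, Complex.ofReal_tsum]
  refine tsum_congr fun h => ?_
  have hc : Summable fun x => conj (iterDiff s h f x) :=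
    summable_of_hasFiniteSupport ((hfin h).subset fun x hx h0 => hx (by simp [h0]))
  have h2 := hs.prod_factor h
  rw [Complex.ofReal_pow, ← Complex.mul_conj', Complex.conj_tsum,
    (hsum h).tsum_mul_tsum hc h2]

/-- For finitely supported `f` and `s ≥ 1`,
`‖f‖_{U^s(ℤ)}^{2^s} = ∑_{x, h_1, …, h_s ∈ ℤ} Δ_{h_1, …, h_s} f (x)`. -/
theorem gowersNorm_pow_eq {f : ℤ → ℂ} (hf : f.support.Finite) {s : ℕ} (hs : 1 ≤ s) :
    ((gowersNorm s f ^ (2 ^ s) : ℝ) : ℂ) = gowersSum s f := by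
  obtain ⟨t, rfl⟩ : ∃ t, s = t + 1 := ⟨s - 1, by omega⟩
  have h1 : gowersNorm (t + 1) f ^ (2 ^ (t + 1)) = ‖gowersSum (t + 1) f‖ := by
    have := Real.rpow_inv_natCast_pow (norm_nonneg (gowersSum (t + 1) f))
      (n := 2 ^ (t + 1)) (by positivity)
    simpa [gowersNorm] using this
  rw [h1, gowersSum_succ hf, Complex.norm_real, Real.norm_of_nonneg]
  exact tsum_nonneg fun _ => by positivity

/-! Write s = t + 2 and let F be the dual function. A large U^s norm says that the derivatives Δ_h
F, h ∈ ℤ^t, have large U² norm on average, so for many h the function Δ_h F correlates with a linear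
phase e(a(h)x/P) (`exists_frequencies`). The point is to show that, on many h, the frequency a(h)
has low rank modulo P: it is a sum of functions each missing one coordinate of h.

This is done by dual–difference interchange (`card_large_phaseForm`). In Δ_h F(x) only the vertex
F(x + ∑ h_i) depends on all coordinates of h. Expanding that factor as an average over n and
applying Cauchy–Schwarz once per coordinate removes all other vertices. For many pairs (h, k) there
remains a large bilinear form in box products of f₀ and f₁, twisted by a linear phase whose
frequency is the alternating sum of a over the cube spanned by h and k. Such a form is controlled by
exponential sums with phase θ⌊√n⌋ - φn (`phaseForm_inverse`). Writing n = m² + j turns these into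
quadratic Weyl sums in m, so φ must lie within δ^{-O(1)}/N of an integer (`sqrt_sum_inverse`). As P
is comparable to N, only δ^{-O(1)} residues of the alternating sum survive, and pigeonholing fixes
both h and the residue (`exists_common_altSum`).

Solving for a(k) in that alternating sum gives the low-rank structure. A second round of
Cauchy–Schwarz removes the low-rank phases and leaves the U^{s-1} norm of F
(`gowersNorm_lower_bound`).

All this needs N larger than a power of δ⁻¹. For smaller N a pointwise lower bound on F and the
diagonal term of the Gowers norm suffice (`gowersNorm_lower_bound_of_small`). -/

namespace DegreeLowering

open Finset

/-! ### Box products and Cauchy–Schwarz on cubes -/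

/-- The box `H^t`. -/
def cube (t : ℕ) (H : Finset ℤ) : Finset (Fin t → ℤ) := Fintype.piFinset fun _ => H

theorem mem_cube {t : ℕ} {H : Finset ℤ} {h : Fin t → ℤ} : h ∈ cube t H ↔ ∀ i, h i ∈ H := by
  simp [cube]

theorem card_cube (t : ℕ) (H : Finset ℤ) : #(cube t H) = #H ^ t := by
  simp [cube]

theorem sum_cube_succ {M : Type*} [AddCommMonoid M] (t : ℕ) (H : Finset ℤ)
    (f : (Fin (t + 1) → ℤ) → M) :
    ∑ h ∈ cube (t + 1) H, f h = ∑ u ∈ H, ∑ h ∈ cube t H, f (Fin.cons u h) := by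
  rw [← sum_product']
  refine sum_nbij' (fun h => (h 0, Fin.tail h)) (fun q => Fin.cons q.1 q.2) ?_ ?_ ?_ ?_ ?_
  · intro h hh
    rw [mem_cube] at hh
    exact mem_product.2 ⟨hh 0, mem_cube.2 fun i => hh i.succ⟩
  · rintro ⟨u, h⟩ hh
    obtain ⟨h1, h2⟩ := mem_product.1 hh
    refine mem_cube.2 fun i => ?_
    refine Fin.cases ?_ (fun j => ?_) i
    · simpa using h1
    · simpa using mem_cube.1 h2 j
  · intro h _
    simp
  · intro q _
    simp
  · intro h _
    simp

/-- The product of `T` over the vertices of the combinatorial cube spanned by `h` and `k`, conjugated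
at the vertices using an odd number of coordinates of `k`. -/
noncomputable def boxProd : (t : ℕ) → ((Fin t → ℤ) → ℂ) → (Fin t → ℤ) → (Fin t → ℤ) → ℂ
  | 0, T, h, _ => T h
  | t + 1, T, h, k =>
    boxProd t (fun u => T (Fin.cons (h 0) u) * conj (T (Fin.cons (k 0) u))) (Fin.tail h)
      (Fin.tail k)

/-- The alternating sum of `a` over the vertices of the combinatorial cube spanned by `h` and `k`. -/
def altSum : (t : ℕ) → ((Fin t → ℤ) → ℤ) → (Fin t → ℤ) → (Fin t → ℤ) → ℤ
  | 0, a, h, _ => a h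
  | t + 1, a, h, k =>
    altSum t (fun u => a (Fin.cons (h 0) u) - a (Fin.cons (k 0) u)) (Fin.tail h) (Fin.tail k)

theorem boxProd_mul : ∀ (t : ℕ) (S T : (Fin t → ℤ) → ℂ) (h k : Fin t → ℤ),
    boxProd t (fun u => S u * T u) h k = boxProd t S h k * boxProd t T h k
  | 0, _, _, _, _ => rfl
  | t + 1, S, T, h, k => by
    simp only [boxProd]
    rw [← boxProd_mul t]
    congr 1
    funext u
    rw [map_mul]
    ring

theorem boxProd_conj : ∀ (t : ℕ) (T : (Fin t → ℤ) → ℂ) (h k : Fin t → ℤ),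
    boxProd t (fun u => conj (T u)) h k = conj (boxProd t T h k)
  | 0, _, _, _ => rfl
  | t + 1, T, h, k => by
    simp only [boxProd]
    rw [← boxProd_conj t]
    congr 1
    funext u
    rw [map_mul]

theorem boxProd_norm_le : ∀ (t : ℕ) (T : (Fin t → ℤ) → ℂ), (∀ u, ‖T u‖ ≤ 1) →
    ∀ h k : Fin t → ℤ, ‖boxProd t T h k‖ ≤ 1
  | 0, _, hT, h, _ => hT h
  | t + 1, T, hT, h, k => by
    refine boxProd_norm_le t _ (fun u => ?_) _ _
    rw [norm_mul, RCLike.norm_conj]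
    exact mul_le_one₀ (hT _) (norm_nonneg _) (hT _)

theorem boxProd_ne_zero : ∀ (t : ℕ) (T : (Fin t → ℤ) → ℂ) (h k : Fin t → ℤ),
    boxProd t T h k ≠ 0 → T h ≠ 0 ∧ T k ≠ 0
  | 0, T, h, k, hne => by
    rw [Subsingleton.elim k h]
    exact ⟨hne, hne⟩
  | t + 1, T, h, k, hne => by
    obtain ⟨h1, h2⟩ := boxProd_ne_zero t _ _ _ hne
    have h3 := left_ne_zero_of_mul h1
    have h4 := right_ne_zero_of_mul h2
    rw [Fin.cons_self_tail] at h3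
    rw [Fin.cons_self_tail] at h4
    exact ⟨h3, fun h0 => h4 (by simp [h0])⟩

/-- Complex conjugation iterated `t` times. -/
noncomputable def conjPow (t : ℕ) : ℂ →+* ℂ := (starRingEnd ℂ) ^ t

theorem conjPow_succ (t : ℕ) (z : ℂ) : conjPow (t + 1) z = conjPow t (conj z) := by
  simp [conjPow, pow_succ]

theorem norm_conjPow : ∀ (t : ℕ) (z : ℂ), ‖conjPow t z‖ = ‖z‖
  | 0, z => by simp [conjPow]
  | t + 1, z => by rw [conjPow_succ, norm_conjPow t, RCLike.norm_conj]

theorem conjPow_conj : ∀ (t : ℕ) (z : ℂ), conjPow t (conj z) = conj (conjPow t z)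
  | 0, z => by simp [conjPow]
  | t + 1, z => by rw [conjPow_succ, conjPow_succ, conjPow_conj t (conj z)]

theorem conjPow_conjPow : ∀ (t : ℕ) (z : ℂ), conjPow t (conjPow t z) = z
  | 0, z => by simp [conjPow]
  | t + 1, z => by
    rw [conjPow_succ, conjPow_succ, ← conjPow_conj, conjPow_conjPow t, Complex.conj_conj]

theorem boxProd_conjPow (t : ℕ) : ∀ (n : ℕ) (T : (Fin t → ℤ) → ℂ) (h k : Fin t → ℤ),
    boxProd t (fun u => conjPow n (T u)) h k = conjPow n (boxProd t T h k)
  | 0, T, h, k => by simp [conjPow]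
  | n + 1, T, h, k => by
    simp only [conjPow_succ]
    rw [boxProd_conjPow t n, boxProd_conj]

/-- Every vertex other than `k` takes some coordinate from `h` and so does not depend on that
coordinate of `k`. Grouping these vertices by the first such coordinate gives the factors `b i`. -/
theorem boxProd_eq_conjPow_mul_prod : ∀ (t : ℕ) (T : (Fin t → ℤ) → ℂ), (∀ u, ‖T u‖ ≤ 1) →
    ∀ h : Fin t → ℤ, ∃ b : Fin t → (Fin t → ℤ) → ℂ, (∀ i k, ‖b i k‖ ≤ 1) ∧
      (∀ i k v, b i (Function.update k i v) = b i k) ∧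
      ∀ k, boxProd t T h k = conjPow t (T k) * ∏ i, b i k
  | 0, T, _, h => by
    refine ⟨fun _ _ => 1, by simp, by simp, fun k => ?_⟩
    simp [boxProd, conjPow, Subsingleton.elim k h]
  | t + 1, T, hT, h => by
    have ih := fun v : ℤ => boxProd_eq_conjPow_mul_prod t (fun u => conj (T (Fin.cons v u)))
      (fun u => by rw [RCLike.norm_conj]; exact hT _) (Fin.tail h)
    choose b hb1 hb2 hb3 using ih
    refine ⟨Fin.cons (fun k => boxProd t (fun u => T (Fin.cons (h 0) u)) (Fin.tail h) (Fin.tail k))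
      (fun i k => b (k 0) i (Fin.tail k)), ?_, ?_, ?_⟩
    · intro i k
      refine Fin.cases ?_ (fun j => ?_) i
      · exact boxProd_norm_le t _ (fun u => hT _) _ _
      · exact hb1 _ _ _
    · intro i k v
      refine Fin.cases ?_ (fun j => ?_) i
      · simp
      · simp only [Fin.cons_succ, Fin.tail_update_succ]
        rw [Function.update_of_ne (Fin.succ_ne_zero j).symm]
        exact hb2 _ _ _ _
    · intro k
      simp only [boxProd, Fin.prod_univ_succ, Fin.cons_zero, Fin.cons_succ]
      rw [boxProd_mul, hb3, conjPow_succ, Fin.cons_self_tail]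
      ring

theorem diffOp_comm (d e : ℤ) (f : ℤ → ℂ) : diffOp d (diffOp e f) = diffOp e (diffOp d f) := by
  funext x
  simp only [diffOp, map_mul, Complex.conj_conj]
  rw [show x + d + e = x + e + d by ring]
  ring

theorem iterDiff_diffOp : ∀ (t : ℕ) (h : Fin t → ℤ) (d : ℤ) (f : ℤ → ℂ),
    iterDiff t h (diffOp d f) = diffOp d (iterDiff t h f)
  | 0, _, _, _ => rfl
  | t + 1, h, d, f => by
    simp only [iterDiff]
    rw [iterDiff_diffOp t, diffOp_comm]

/-- The vertices of the cube spanned by `h` and `k` map to x + ∑ h_i plus the subset sums of k - h,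
which are the points entering the iterated derivative. -/
theorem boxProd_translate : ∀ (t : ℕ) (f : ℤ → ℂ) (x : ℤ) (h k : Fin t → ℤ),
    boxProd t (fun u => f (x + ∑ i, u i)) h k = iterDiff t (k - h) f (x + ∑ i, h i)
  | 0, f, x, h, k => by simp [boxProd, iterDiff]
  | t + 1, f, x, h, k => by
    have key := boxProd_translate t (diffOp (k 0 - h 0) f) (x + h 0) (Fin.tail h) (Fin.tail k)
    rw [iterDiff_diffOp] at key
    simp only [boxProd, iterDiff, Fin.sum_univ_succ, Fin.cons_zero, Fin.cons_succ, Pi.sub_apply]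
    rw [show Fin.tail (k - h) = Fin.tail k - Fin.tail h from rfl, ← add_assoc]
    rw [show (∑ i : Fin t, h i.succ) = ∑ i, Fin.tail h i from rfl, ← key]
    congr 1
    funext u
    simp only [diffOp]
    rw [show x + (h 0 + ∑ i, u i) = x + h 0 + ∑ i, u i by ring,
      show x + (k 0 + ∑ i, u i) = x + h 0 + ∑ i, u i + (k 0 - h 0) by ring]

/-- Cauchy–Schwarz for box products: functions independent of one of the coordinates are
eliminated. -/
theorem box_cauchy_schwarz (H : Finset ℤ) : ∀ (t : ℕ) {ι : Type} (Z : Finset ι)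
    (T : ι → (Fin t → ℤ) → ℂ) (b : ι → Fin t → (Fin t → ℤ) → ℂ), (∀ z i h, ‖b z i h‖ ≤ 1) →
    (∀ z i h v, b z i (Function.update h i v) = b z i h) →
    (#Z : ℝ) * (#H : ℝ) ^ (2 * t) * ‖∑ z ∈ Z, ∑ h ∈ cube t H, T z h * ∏ i, b z i h‖ ^ (2 ^ t) ≤
      (#Z : ℝ) ^ (2 ^ t) * (#H : ℝ) ^ (t * 2 ^ t) *
        ‖∑ z ∈ Z, ∑ h ∈ cube t H, ∑ k ∈ cube t H, boxProd t (T z) h k‖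
  | 0, ι, Z, T, b, _, _ => by
    simp [boxProd, cube]
  | t + 1, ι, Z, T, b, hb, hind => by
    set Y : ι → (Fin t → ℤ) → ℂ := fun z h => ∑ u ∈ H, T z (Fin.cons u h) *
      ∏ i, b z (Fin.succ i) (Fin.cons u h) with hY
    set X := ∑ z ∈ Z, ∑ h ∈ cube (t + 1) H, T z h * ∏ i, b z i h with hX
    -- The factor with index 0 ignores coordinate 0, so the value 0 placed there is arbitrary; the
    -- factor can then leave the sum over that coordinate.
    have hb0 : ∀ z u (h : Fin t → ℤ), b z 0 (Fin.cons u h : Fin (t + 1) → ℤ) =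
        b z 0 (Fin.cons 0 h : Fin (t + 1) → ℤ) := by
      intro z u h
      rw [← hind z 0 (Fin.cons 0 h) u, Fin.update_cons_zero]
    have hX' : X = ∑ q ∈ Z ×ˢ cube t H, b q.1 0 (Fin.cons 0 q.2 : Fin (t + 1) → ℤ) * Y q.1 q.2 := by
      rw [hX, sum_product]
      refine sum_congr rfl fun z _ => ?_
      rw [sum_cube_succ, sum_comm]
      refine sum_congr rfl fun h _ => ?_
      rw [hY, mul_sum]
      refine sum_congr rfl fun u _ => ?_
      rw [Fin.prod_univ_succ, hb0]
      ring
    have h1 : ‖X‖ ^ 2 ≤ (#Z : ℝ) * (#H : ℝ) ^ t * ∑ q ∈ Z ×ˢ cube t H, ‖Y q.1 q.2‖ ^ 2 := by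
      have h2 : ‖X‖ ≤ ∑ q ∈ Z ×ˢ cube t H, ‖Y q.1 q.2‖ := by
        rw [hX']
        refine (norm_sum_le _ _).trans (sum_le_sum fun q _ => ?_)
        rw [norm_mul]
        exact mul_le_of_le_one_left (norm_nonneg _) (hb _ _ _)
      calc ‖X‖ ^ 2 ≤ (∑ q ∈ Z ×ˢ cube t H, ‖Y q.1 q.2‖) ^ 2 := by gcongr
        _ ≤ (#(Z ×ˢ cube t H) : ℝ) * ∑ q ∈ Z ×ˢ cube t H, ‖Y q.1 q.2‖ ^ 2 :=
          sq_sum_le_card_mul_sum_sq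
        _ = _ := by rw [card_product, card_cube]; push_cast; ring
    -- Squaring out doubles the eliminated coordinate. The two copies become parameters, which is
    -- why the induction is over arbitrary index sets.
    set T' : ι × ℤ × ℤ → (Fin t → ℤ) → ℂ := fun z h =>
      T z.1 (Fin.cons z.2.1 h) * conj (T z.1 (Fin.cons z.2.2 h)) with hT'
    set b' : ι × ℤ × ℤ → Fin t → (Fin t → ℤ) → ℂ := fun z i h =>
      b z.1 i.succ (Fin.cons z.2.1 h) * conj (b z.1 i.succ (Fin.cons z.2.2 h)) with hb'
    have h3 : ((∑ q ∈ Z ×ˢ cube t H, ‖Y q.1 q.2‖ ^ 2 : ℝ) : ℂ) =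
        ∑ z ∈ Z ×ˢ (H ×ˢ H), ∑ h ∈ cube t H, T' z h * ∏ i, b' z i h := by
      rw [sum_product, sum_product, Complex.ofReal_sum]
      refine sum_congr rfl fun z _ => ?_
      rw [sum_comm, Complex.ofReal_sum]
      refine sum_congr rfl fun h _ => ?_
      rw [Complex.ofReal_pow, ← Complex.mul_conj', hY, map_sum, sum_mul_sum, ← sum_product']
      refine sum_congr rfl fun q _ => ?_
      simp only [hT', hb', map_mul, map_prod, prod_mul_distrib]
      ring
    have ih := box_cauchy_schwarz H t (Z ×ˢ (H ×ˢ H)) T' b'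
      (fun z i h => by
        rw [norm_mul, RCLike.norm_conj]
        exact mul_le_one₀ (hb _ _ _) (norm_nonneg _) (hb _ _ _))
      (fun z i h v => by
        simp only [hb', Fin.cons_update, hind])
    rw [← h3, Complex.norm_real, Real.norm_of_nonneg (by positivity)] at ih
    have h4 : ∑ z ∈ Z ×ˢ (H ×ˢ H), ∑ h ∈ cube t H, ∑ k ∈ cube t H, boxProd t (T' z) h k =
        ∑ z ∈ Z, ∑ h ∈ cube (t + 1) H, ∑ k ∈ cube (t + 1) H, boxProd (t + 1) (T z) h k := by
      rw [sum_product]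
      refine sum_congr rfl fun z _ => ?_
      rw [sum_product, sum_cube_succ]
      refine sum_congr rfl fun u _ => ?_
      rw [sum_comm]
      refine sum_congr rfl fun h _ => ?_
      rw [sum_cube_succ]
      refine sum_congr rfl fun v _ => ?_
      simp [boxProd, hT']
    rw [h4] at ih
    set B := ‖∑ z ∈ Z, ∑ h ∈ cube (t + 1) H, ∑ k ∈ cube (t + 1) H, boxProd (t + 1) (T z) h k‖
    set D := ∑ q ∈ Z ×ˢ cube t H, ‖Y q.1 q.2‖ ^ 2 with hD
    have hD0 : 0 ≤ D := by positivity
    have hc : (#(Z ×ˢ (H ×ˢ H)) : ℝ) = (#Z : ℝ) * (#H : ℝ) ^ 2 := by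
      rw [card_product, card_product]; push_cast; ring
    rw [hc] at ih
    set a : ℝ := (#Z : ℝ)
    set c : ℝ := (#H : ℝ)
    have ha : 0 ≤ a := by positivity
    have hc0 : 0 ≤ c := by positivity
    calc a * c ^ (2 * (t + 1)) * ‖X‖ ^ (2 ^ (t + 1))
        = a * c ^ (2 * (t + 1)) * (‖X‖ ^ 2) ^ (2 ^ t) := by rw [← pow_mul, pow_succ' 2 t]
      _ ≤ a * c ^ (2 * (t + 1)) * (a * c ^ t * D) ^ (2 ^ t) := by gcongr
      _ = (a * c ^ t) ^ (2 ^ t) * (a * c ^ 2 * c ^ (2 * t) * D ^ (2 ^ t)) := by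
        rw [mul_pow (a * c ^ t)]; ring
      _ ≤ (a * c ^ t) ^ (2 ^ t) * ((a * c ^ 2) ^ (2 ^ t) * c ^ (t * 2 ^ t) * B) := by gcongr
      _ = a ^ (2 ^ (t + 1)) * c ^ ((t + 1) * 2 ^ (t + 1)) * B := by
        rw [mul_pow, mul_pow, ← pow_mul, ← pow_mul, pow_succ 2 t, pow_mul a, sq (a ^ 2 ^ t)]
        rw [show (t + 1) * (2 ^ t * 2) = t * 2 ^ t + 2 * 2 ^ t + t * 2 ^ t by ring, pow_add, pow_add]
        ring

theorem box_lower_bound (H : Finset ℤ) (t : ℕ) {ι : Type} (Z : Finset ι)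
    (T : ι → (Fin t → ℤ) → ℂ) (b : ι → Fin t → (Fin t → ℤ) → ℂ) (hb : ∀ z i h, ‖b z i h‖ ≤ 1)
    (hind : ∀ z i h v, b z i (Function.update h i v) = b z i h) (hZ : Z.Nonempty)
    (hH : H.Nonempty) {ξ : ℝ} (hξ : 0 ≤ ξ)
    (hT : ξ * (#Z * (#H : ℝ) ^ t) ≤ ‖∑ z ∈ Z, ∑ h ∈ cube t H, T z h * ∏ i, b z i h‖) :
    ξ ^ (2 ^ t) * (#Z * (#H : ℝ) ^ (2 * t)) ≤
      ‖∑ z ∈ Z, ∑ h ∈ cube t H, ∑ k ∈ cube t H, boxProd t (T z) h k‖ := by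
  have h1 := box_cauchy_schwarz H t Z T b hb hind
  have ha : (0 : ℝ) < #Z := by exact_mod_cast hZ.card_pos
  have hc : (0 : ℝ) < #H := by exact_mod_cast hH.card_pos
  have h2 := pow_le_pow_left₀ (by positivity) hT (2 ^ t)
  have h3 : (0 : ℝ) < (#Z : ℝ) ^ (2 ^ t) * (#H : ℝ) ^ (t * 2 ^ t) := by positivity
  refine le_of_mul_le_mul_left ?_ h3
  refine le_trans (le_of_eq ?_) ((mul_le_mul_of_nonneg_left h2
    (by positivity : (0 : ℝ) ≤ #Z * (#H : ℝ) ^ (2 * t))).trans h1)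
  rw [mul_pow, mul_pow, ← pow_mul]
  ring

/-! ### Additive characters, geometric sums and Parseval modulo P -/

/-- The additive character `x ↦ exp (2πix)`. -/
noncomputable def expi (x : ℝ) : ℂ := Complex.exp (Complex.I * ((2 * Real.pi * x : ℝ) : ℂ))

theorem expi_add (x y : ℝ) : expi (x + y) = expi x * expi y := by
  rw [expi, expi, expi, ← Complex.exp_add]
  congr 1
  push_cast
  ring

theorem expi_zero : expi 0 = 1 := by simp [expi]

theorem norm_expi (x : ℝ) : ‖expi x‖ = 1 := by
  rw [expi, mul_comm, Complex.norm_exp_ofReal_mul_I]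

theorem conj_expi (x : ℝ) : conj (expi x) = expi (-x) := by
  rw [expi, expi, ← Complex.exp_conj, map_mul, Complex.conj_I, Complex.conj_ofReal]
  congr 1
  push_cast
  ring

theorem expi_intCast (n : ℤ) : expi n = 1 := by
  rw [expi, Complex.exp_eq_one_iff]
  exact ⟨n, by push_cast; ring⟩

theorem expi_add_intCast (x : ℝ) (n : ℤ) : expi (x + n) = expi x := by
  rw [expi_add, expi_intCast, mul_one]

theorem expi_nat_mul (x : ℝ) (n : ℕ) : expi (n * x) = expi x ^ n := by
  rw [expi, expi, ← Complex.exp_nat_mul]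
  congr 1
  push_cast
  ring

theorem four_mul_abs_le_norm_expi_sub_one {x : ℝ} (hx : |x| ≤ 1 / 2) : 4 * |x| ≤ ‖expi x - 1‖ := by
  rw [expi, Complex.norm_exp_I_mul_ofReal_sub_one, show 2 * Real.pi * x / 2 = Real.pi * x by ring,
    norm_mul, Real.norm_eq_abs, Real.norm_eq_abs, abs_two]
  have h1 := Real.mul_abs_le_abs_sin (x := Real.pi * x) (by
    rw [abs_mul, abs_of_pos Real.pi_pos]
    nlinarith [Real.pi_pos])
  rw [abs_mul, abs_of_pos Real.pi_pos] at h1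
  have h2 : 2 / Real.pi * (Real.pi * |x|) = 2 * |x| := by
    field_simp
  linarith

theorem norm_sum_range_expi_le {x : ℝ} (hx0 : x ≠ 0) (hx : |x| ≤ 1 / 2) (n : ℕ) :
    ‖∑ i ∈ range n, expi x ^ i‖ ≤ 1 / (2 * |x|) := by
  have h1 : 0 < |x| := abs_pos.2 hx0
  have h2 := four_mul_abs_le_norm_expi_sub_one hx
  have h3 := congrArg norm (geom_sum_mul (expi x) n)
  rw [norm_mul] at h3
  have h4 : ‖expi x ^ n - 1‖ ≤ 2 := by
    refine (norm_sub_le _ _).trans ?_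
    rw [norm_pow, norm_expi]
    norm_num
  rw [le_div_iff₀ (by positivity)]
  have h5 := mul_le_mul_of_nonneg_left h2 (norm_nonneg (∑ i ∈ range n, expi x ^ i))
  linarith

theorem norm_sum_Ico_expi_le {x : ℝ} (hx0 : x ≠ 0) (hx : |x| ≤ 1 / 2) (a b : ℤ) :
    ‖∑ m ∈ Ico a b, expi (x * m)‖ ≤ 1 / (2 * |x|) := by
  have h1 : ∑ m ∈ Ico a b, expi (x * m) =
      expi (x * a) * ∑ i ∈ range (b - a).toNat, expi x ^ i := by
    rw [mul_sum]
    refine sum_nbij' (fun m => (m - a).toNat) (fun i => a + i) ?_ ?_ ?_ ?_ ?_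
    · intro m hm
      simp only [mem_Ico, mem_range] at hm ⊢
      omega
    · intro m hm
      simp only [mem_Ico, mem_range] at hm ⊢
      omega
    · intro m hm
      simp only [mem_Ico] at hm
      omega
    · intro m hm
      omega
    · intro m hm
      simp only [mem_Ico] at hm
      rw [← expi_nat_mul, ← expi_add]
      congr 1
      have h2 : (((m - a).toNat : ℤ) : ℝ) = ((m - a : ℤ) : ℝ) := by
        rw [Int.toNat_of_nonneg (by omega)]
      rw [Int.cast_natCast] at h2
      rw [h2]
      push_cast
      ring
  rw [h1, norm_mul, norm_expi, one_mul]
  exact norm_sum_range_expi_le hx0 hx _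

theorem expi_div_ne_one {P : ℕ} {k : ℤ} (hk : |k| < P) (hk0 : k ≠ 0) : expi (k / P) ≠ 1 := by
  intro h
  rw [expi, Complex.exp_eq_one_iff] at h
  obtain ⟨n, hn⟩ := h
  have hP : (0 : ℤ) < P := (abs_nonneg k).trans_lt hk
  have hPr : (P : ℝ) ≠ 0 := by
    have : (P : ℤ) ≠ 0 := hP.ne'
    exact_mod_cast this
  have h1 : ((2 * Real.pi * (k / P : ℝ) : ℝ) : ℂ) = ((2 * Real.pi * n : ℝ) : ℂ) := by
    have := mul_left_cancel₀ Complex.I_ne_zero (hn.trans (by push_cast; ring :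
      (n : ℂ) * (2 * Real.pi * Complex.I) = Complex.I * ((2 * Real.pi * n : ℝ) : ℂ)))
    exact this
  have h2 := Complex.ofReal_injective h1
  have h3 : (k / P : ℝ) = n := mul_left_cancel₀ (by positivity : (2 * Real.pi) ≠ 0) h2
  rw [div_eq_iff hPr] at h3
  have h4 : k = n * P := by exact_mod_cast h3
  have h5 : (P : ℤ) ∣ k := ⟨n, by rw [h4]; ring⟩
  exact hk0 (Int.eq_zero_of_abs_lt_dvd h5 hk)

theorem sum_expi_eq_ite {P : ℕ} {k : ℤ} (hk : |k| < P) :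
    ∑ b ∈ range P, expi (b * k / P) = if k = 0 then (P : ℂ) else 0 := by
  split_ifs with h0
  · simp [h0, expi_zero]
  · have hP : (P : ℝ) ≠ 0 := by
      have : (P : ℤ) ≠ 0 := ((abs_nonneg k).trans_lt hk).ne'
      exact_mod_cast this
    have h1 : ∀ b ∈ range P, expi (b * k / P) = expi (k / P) ^ b := by
      intro b _
      rw [← expi_nat_mul, mul_div_assoc]
    rw [sum_congr rfl h1]
    have h2 := geom_sum_mul (expi (k / P)) P
    rw [← expi_nat_mul, mul_div_cancel₀ _ hP, expi_intCast, sub_self] at h2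
    exact (mul_eq_zero.1 h2).resolve_right (sub_ne_zero.2 (expi_div_ne_one hk h0))

/-- Parseval on ℤ/P: distinct points of `S` stay distinct modulo P, so orthogonality leaves only the
diagonal. -/
theorem sum_norm_sq_expi_eq {P : ℕ} (u : ℤ → ℂ) (S : Finset ℤ)
    (hS : ∀ k ∈ S, ∀ l ∈ S, |k - l| < P) :
    ∑ b ∈ range P, ‖∑ k ∈ S, u k * expi (b * k / P)‖ ^ 2 = P * ∑ k ∈ S, ‖u k‖ ^ 2 := by
  have h1 : ∀ b ∈ range P, ((‖∑ k ∈ S, u k * expi (b * k / P)‖ ^ 2 : ℝ) : ℂ) =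
      ∑ k ∈ S, ∑ l ∈ S, u k * conj (u l) * expi (b * ((k - l : ℤ) : ℝ) / P) := by
    intro b _
    rw [Complex.ofReal_pow, ← Complex.mul_conj', map_sum, sum_mul_sum]
    refine sum_congr rfl fun k _ => sum_congr rfl fun l _ => ?_
    rw [map_mul, conj_expi, show (b * ((k - l : ℤ) : ℝ) / P : ℝ) = b * k / P + -(b * l / P) by
      push_cast; ring, expi_add]
    ring
  have h2 : ((∑ b ∈ range P, ‖∑ k ∈ S, u k * expi (b * k / P)‖ ^ 2 : ℝ) : ℂ) =
      ((P * ∑ k ∈ S, ‖u k‖ ^ 2 : ℝ) : ℂ) := by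
    rw [Complex.ofReal_sum, sum_congr rfl h1, sum_comm, Complex.ofReal_mul, Complex.ofReal_sum,
      mul_sum]
    refine sum_congr rfl fun k hk => ?_
    rw [sum_comm]
    have h3 : ∀ l ∈ S, ∑ b ∈ range P, u k * conj (u l) * expi (b * ((k - l : ℤ) : ℝ) / P) =
        if l = k then (P : ℂ) * (‖u k‖ ^ 2 : ℝ) else 0 := by
      intro l hl
      rw [← mul_sum, sum_expi_eq_ite (hS k hk l hl)]
      by_cases h : l = k
      · rw [h, sub_self, if_pos rfl, if_pos rfl, Complex.mul_conj', Complex.ofReal_pow]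
        ring
      · rw [if_neg h, if_neg (fun h' => h (sub_eq_zero.1 h').symm), mul_zero]
    rw [sum_congr rfl h3, sum_ite_eq' S k, if_pos hk]
    simp
  exact Complex.ofReal_injective h2

theorem sum_sub_eq_sum {M : Type*} [AddCommMonoid M] (f : ℤ → M) (S S' : Finset ℤ) (τ : ℤ)
    (h : ∀ y, f y ≠ 0 → y ∈ S' ∧ y + τ ∈ S) : ∑ k ∈ S, f (k - τ) = ∑ y ∈ S', f y := by
  rw [← finsum_eq_sum_of_support_subset f (s := S') (fun y hy => (h y hy).1),
    ← finsum_eq_sum_of_support_subset (fun k => f (k - τ)) (s := S) (fun y hy => by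
      have := (h _ hy).2
      simpa using this)]
  exact finsum_comp_equiv (Equiv.subRight τ) (f := f)

/-- Young's inequality `‖c * g‖₂ ≤ ‖ĉ‖_∞ ‖g‖₂`, with the Fourier transform taken modulo `P`. -/
theorem sum_norm_sq_conv_le {ι : Type*} (Λ : Finset ι) (c : ι → ℂ) (τ : ι → ℤ) (g : ℤ → ℂ)
    {A P : ℕ} (hP : 4 * A < P) (hτ : ∀ n ∈ Λ, |τ n| ≤ A) (hg : ∀ y, g y ≠ 0 → |y| ≤ A)
    {B : ℝ} (hB : ∀ b < P, ‖∑ n ∈ Λ, c n * expi (b * τ n / P)‖ ≤ B) :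
    ∑ k ∈ Icc (-(2 * A : ℤ)) (2 * A), ‖∑ n ∈ Λ, c n * g (k - τ n)‖ ^ 2 ≤
      B ^ 2 * ∑ y ∈ Icc (-(A : ℤ)) A, ‖g y‖ ^ 2 := by
  have hPpos : (0 : ℝ) < P := by
    have : 0 < P := by omega
    exact_mod_cast this
  have h1 := sum_norm_sq_expi_eq (P := P) (fun k => ∑ n ∈ Λ, c n * g (k - τ n))
    (Icc (-(2 * A : ℤ)) (2 * A)) (by
      intro k hk l hl
      rw [mem_Icc] at hk hl
      rw [abs_lt]
      omega)
  have h2 := sum_norm_sq_expi_eq (P := P) g (Icc (-(A : ℤ)) A) (by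
      intro k hk l hl
      rw [mem_Icc] at hk hl
      rw [abs_lt]
      omega)
  have h3 : ∀ b ∈ range P, ∑ k ∈ Icc (-(2 * A : ℤ)) (2 * A), (∑ n ∈ Λ, c n * g (k - τ n)) *
      expi (b * k / P) = (∑ n ∈ Λ, c n * expi (b * τ n / P)) *
        ∑ y ∈ Icc (-(A : ℤ)) A, g y * expi (b * y / P) := by
    intro b _
    simp_rw [sum_mul]
    rw [sum_comm]
    refine sum_congr rfl fun n hn => ?_
    have h4 := sum_sub_eq_sum (fun y => g y * expi (b * y / P)) (Icc (-(2 * A : ℤ)) (2 * A))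
      (Icc (-(A : ℤ)) A) (τ n) (by
        intro y hy
        have h5 := abs_le.1 (hg y (left_ne_zero_of_mul hy))
        have h6 := abs_le.1 (hτ n hn)
        simp only [mem_Icc]
        omega)
    rw [← h4, mul_sum]
    refine sum_congr rfl fun k _ => ?_
    rw [show (b * k / P : ℝ) = b * τ n / P + b * ((k - τ n : ℤ) : ℝ) / P by push_cast; ring,
      expi_add]
    ring
  have h7 : P * ∑ k ∈ Icc (-(2 * A : ℤ)) (2 * A), ‖∑ n ∈ Λ, c n * g (k - τ n)‖ ^ 2 ≤
      P * (B ^ 2 * ∑ y ∈ Icc (-(A : ℤ)) A, ‖g y‖ ^ 2) := by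
    rw [← h1, mul_left_comm, ← h2, mul_sum]
    refine sum_le_sum fun b hb => ?_
    rw [h3 b hb, norm_mul, mul_pow]
    have := hB b (mem_range.1 hb)
    gcongr
  exact le_of_mul_le_mul_left h7 hPpos

/-! ### Quadratic Weyl sums -/

theorem exists_eq_Ico (S : Finset ℤ) (hS : ∀ x ∈ S, ∀ y ∈ S, ∀ z, x ≤ z → z ≤ y → z ∈ S) :
    ∃ a b : ℤ, S = Ico a b ∧ b - a ≤ #S := by
  rcases S.eq_empty_or_nonempty with rfl | hne
  · exact ⟨0, 0, by simp⟩
  · have h : S = Ico (S.min' hne) (S.max' hne + 1) := by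
      ext z
      rw [mem_Ico]
      refine ⟨fun hz => ⟨S.min'_le z hz, Int.lt_add_one_of_le (S.le_max' z hz)⟩, fun hz => ?_⟩
      exact hS _ (S.min'_mem hne) _ (S.max'_mem hne) z hz.1 (Int.le_of_lt_add_one hz.2)
    refine ⟨_, _, h, ?_⟩
    have h2 := congrArg Finset.card h
    rw [Int.card_Ico] at h2
    rw [h2]
    exact Int.self_le_toNat _

theorem norm_sq_sum_Ico_eq (u : ℤ → ℂ) (a b : ℤ) :
    ((‖∑ m ∈ Ico a b, u m‖ ^ 2 : ℝ) : ℂ) = ∑ d ∈ Ioo (a - b) (b - a),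
      ∑ m ∈ Ico (max a (a - d)) (min b (b - d)), u (m + d) * conj (u m) := by
  rw [Complex.ofReal_pow, ← Complex.mul_conj', map_sum, sum_mul_sum, ← sum_product',
    sum_sigma' (Ioo (a - b) (b - a))]
  refine sum_nbij' (fun q => ⟨q.1 - q.2, q.2⟩) (fun q => (q.2 + q.1, q.2)) ?_ ?_ ?_ ?_ ?_
  · intro q hq
    simp only [mem_product, mem_Ico, mem_sigma, mem_Ioo] at hq ⊢
    omega
  · intro q hq
    simp only [mem_product, mem_Ico, mem_sigma, mem_Ioo] at hq ⊢
    omega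
  · intro q _
    simp
  · intro q _
    simp
  · intro q _
    simp

/-- Weyl differencing: the shift d leaves a linear phase of frequency -2φd. Shifts with |d| ≤ κH are
bounded trivially, the others by the geometric series; `hφH` keeps all these frequencies within
[-1/2, 1/2]. -/
theorem norm_quadratic_sum_sq_le {φ θ H κ : ℝ} {a b : ℤ} (hH : 0 < H) (hab : (b - a : ℝ) ≤ H)
    (hφ : φ ≠ 0) (hφH : 2 * |φ| * H ≤ 1 / 2) (hκ : 0 < κ) :
    ‖∑ m ∈ Ico a b, expi (θ * m - φ * m ^ 2)‖ ^ 2 ≤ 2 * κ * H ^ 2 + H + 1 / (2 * |φ| * κ) := by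
  have hφ0 : 0 < |φ| := abs_pos.2 hφ
  set I : ℤ → ℂ := fun d => ∑ m ∈ Ico (max a (a - d)) (min b (b - d)),
    expi (θ * (m + d : ℤ) - φ * (m + d : ℤ) ^ 2) * conj (expi (θ * m - φ * m ^ 2)) with hI
  have h0 := norm_sq_sum_Ico_eq (fun m => expi (θ * m - φ * m ^ 2)) a b
  have h1 : ‖∑ m ∈ Ico a b, expi (θ * m - φ * m ^ 2)‖ ^ 2 ≤ ∑ d ∈ Ioo (a - b) (b - a), ‖I d‖ := by
    have := congrArg norm h0
    rw [Complex.norm_real, Real.norm_of_nonneg (by positivity)] at this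
    rw [this]
    exact norm_sum_le _ _
  have htriv : ∀ d ∈ Ioo (a - b) (b - a), ‖I d‖ ≤ H := by
    intro d hd
    rw [mem_Ioo] at hd
    refine (norm_sum_le _ _).trans ?_
    have h2 : ∀ m ∈ Ico (max a (a - d)) (min b (b - d)),
        ‖expi (θ * (m + d : ℤ) - φ * (m + d : ℤ) ^ 2) * conj (expi (θ * m - φ * m ^ 2))‖ = 1 := by
      intro m _
      rw [norm_mul, RCLike.norm_conj, norm_expi, norm_expi, one_mul]
    rw [sum_congr rfl h2, sum_const, Int.card_Ico, nsmul_eq_mul, mul_one]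
    have h3 : ((min b (b - d) - max a (a - d)).toNat : ℤ) ≤ b - a := by omega
    have h4 : ((min b (b - d) - max a (a - d)).toNat : ℝ) ≤ (b - a : ℝ) := by exact_mod_cast h3
    exact h4.trans hab
  have hgeom : ∀ d ∈ Ioo (a - b) (b - a), d ≠ 0 → ‖I d‖ ≤ 1 / (4 * |φ| * |(d : ℝ)|) := by
    intro d hd hd0
    rw [mem_Ioo] at hd
    have hd1 : |(d : ℝ)| ≤ H := by
      refine le_trans ?_ hab
      have : |d| ≤ b - a := by rw [abs_le]; omega
      exact_mod_cast this
    have hd2 : (d : ℝ) ≠ 0 := by exact_mod_cast hd0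
    have h2 : I d = expi (θ * d - φ * d ^ 2) * ∑ m ∈ Ico (max a (a - d)) (min b (b - d)),
        expi ((-2 * φ * d) * m) := by
      rw [hI, mul_sum]
      refine sum_congr rfl fun m _ => ?_
      rw [conj_expi, ← expi_add, ← expi_add]
      congr 1
      push_cast
      ring
    rw [h2, norm_mul, norm_expi, one_mul]
    have h3 : |(-2 * φ * d : ℝ)| = 2 * |φ| * |(d : ℝ)| := by
      rw [abs_mul, abs_mul]
      norm_num
    refine (norm_sum_Ico_expi_le (mul_ne_zero (mul_ne_zero (by norm_num) hφ) hd2) ?_ _ _).trans ?_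
    · rw [h3]
      exact (mul_le_mul_of_nonneg_left hd1 (by positivity)).trans hφH
    · rw [h3]
      exact le_of_eq (by ring)
  refine h1.trans ?_
  rw [← sum_filter_add_sum_filter_not (Ioo (a - b) (b - a)) (fun d : ℤ => |(d : ℝ)| ≤ κ * H)]
  have hA : ∑ d ∈ (Ioo (a - b) (b - a)).filter (fun d : ℤ => |(d : ℝ)| ≤ κ * H), ‖I d‖ ≤
      (2 * (κ * H) + 1) * H := by
    refine (sum_le_card_nsmul _ _ H fun d hd => htriv d (mem_filter.1 hd).1).trans ?_
    rw [nsmul_eq_mul]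
    gcongr
    have h2 : (Ioo (a - b) (b - a)).filter (fun d : ℤ => |(d : ℝ)| ≤ κ * H) ⊆
        Icc (-⌊κ * H⌋) ⌊κ * H⌋ := by
      intro d hd
      have h3 := (mem_filter.1 hd).2
      rw [← Int.cast_abs, ← Int.le_floor] at h3
      rw [mem_Icc]
      exact abs_le.1 h3
    have h4 := card_le_card h2
    rw [Int.card_Icc] at h4
    have h5 : 0 ≤ ⌊κ * H⌋ := Int.floor_nonneg.2 (by positivity)
    have h6 : (#((Ioo (a - b) (b - a)).filter (fun d : ℤ => |(d : ℝ)| ≤ κ * H)) : ℤ) ≤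
        2 * ⌊κ * H⌋ + 1 := by omega
    have h7 : (#((Ioo (a - b) (b - a)).filter (fun d : ℤ => |(d : ℝ)| ≤ κ * H)) : ℝ) ≤
        2 * (⌊κ * H⌋ : ℝ) + 1 := by exact_mod_cast h6
    linarith [Int.floor_le (κ * H)]
  have hB : ∑ d ∈ (Ioo (a - b) (b - a)).filter (fun d : ℤ => ¬ |(d : ℝ)| ≤ κ * H), ‖I d‖ ≤
      2 * H * (1 / (4 * |φ| * (κ * H))) := by
    refine (sum_le_card_nsmul _ _ (1 / (4 * |φ| * (κ * H))) fun d hd => ?_).trans ?_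
    · obtain ⟨h2, h3⟩ := mem_filter.1 hd
      have h4 : κ * H < |(d : ℝ)| := not_le.1 h3
      have h5 : d ≠ 0 := by
        rintro rfl
        simp only [Int.cast_zero, abs_zero] at h4
        exact absurd h4 (not_lt.2 (by positivity))
      refine (hgeom d h2 h5).trans ?_
      gcongr
    · rw [nsmul_eq_mul]
      gcongr
      have h2 := card_le_card (filter_subset (fun d : ℤ => ¬ |(d : ℝ)| ≤ κ * H)
        (Ioo (a - b) (b - a)))
      rw [Int.card_Ioo] at h2
      rcases le_total a b with hle | hle
      · have h6 : (#((Ioo (a - b) (b - a)).filter (fun d : ℤ => ¬ |(d : ℝ)| ≤ κ * H)) : ℤ) ≤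
            2 * (b - a) := by omega
        have h7 : (#((Ioo (a - b) (b - a)).filter (fun d : ℤ => ¬ |(d : ℝ)| ≤ κ * H)) : ℝ) ≤
            2 * (b - a : ℝ) := by exact_mod_cast h6
        linarith
      · have h6 : #((Ioo (a - b) (b - a)).filter (fun d : ℤ => ¬ |(d : ℝ)| ≤ κ * H)) = 0 := by
          omega
        rw [h6, Nat.cast_zero]
        positivity
  have hC : 2 * H * (1 / (4 * |φ| * (κ * H))) = 1 / (2 * |φ| * κ) := by
    field_simp
    norm_num
  rw [hC] at hB
  nlinarith

theorem norm_sum_Ico_le_of_blocks (f : ℤ → ℂ) (H : ℕ) {B : ℝ} (hB0 : 0 ≤ B)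
    (hB : ∀ a b : ℤ, b - a ≤ H → ‖∑ m ∈ Ico a b, f m‖ ≤ B) :
    ∀ (k : ℕ) (a b : ℤ), b - a ≤ k * H → ‖∑ m ∈ Ico a b, f m‖ ≤ k * B
  | 0, a, b, h => by
    rw [Ico_eq_empty (by simp at h; omega)]
    simp
  | k + 1, a, b, h => by
    rcases le_total (b - a) H with h1 | h1
    · refine (hB a b h1).trans ?_
      push_cast
      nlinarith [mul_nonneg (Nat.cast_nonneg (α := ℝ) k) hB0]
    · have h2 : Ico a b = Ico a (a + H) ∪ Ico (a + H) b :=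
        (Ico_union_Ico_eq_Ico (by omega) (by omega)).symm
      rw [h2, sum_union (Ico_disjoint_Ico_consecutive _ _ _)]
      have h3 := hB a (a + H) (by omega)
      have h4 := norm_sum_Ico_le_of_blocks f H hB0 hB k (a + H) b (by push_cast at h; linarith)
      refine (norm_add_le _ _).trans ?_
      push_cast
      linarith

/-- Here φ is too large for differencing on the whole interval, so the interval is cut into blocks
of length about H = 1/(4|φ|). By `hφ` one has H ≥ ηM/4, so the blocks are still long enough for the
Weyl bound on them to limit M. -/
theorem quadratic_sum_inverse_of_large_frequency {M η φ θ : ℝ} {a b : ℤ} (hM0 : 0 < M) (hη : 0 < η)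
    (hη1 : η ≤ 1) (hφp : 0 < |φ|) (hφ : |φ| * (η * M) ≤ 1) (hab : (b - a : ℝ) ≤ 2 * M)
    (hS : η * M / 3 ≤ ‖∑ m ∈ Ico a b, expi (θ * m - φ * m ^ 2)‖) (hbig1 : 4 ≤ M * η)
    (hcase : 1 < 8 * M * |φ|) : M * η ^ 5 ≤ 7 * 10 ^ 6 := by
  have hφ0 : φ ≠ 0 := abs_pos.1 hφp
  set H : ℝ := 1 / (4 * |φ|) with hH
  have hH0 : 0 < H := by positivity
  have hφH : |φ| * H = 1 / 4 := by
    rw [hH]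
    field_simp
  have hHM : H ≤ 2 * M := by
    rw [hH, div_le_iff₀ (by positivity)]
    linarith
  have hHl : η * M ≤ 4 * H := by
    rw [hH]
    rw [show 4 * (1 / (4 * |φ|)) = 1 / |φ| by field_simp, le_div_iff₀ hφp]
    linarith
  have hH1 : 1 ≤ H := by linarith
  set n := ⌊H⌋₊ with hn
  have hn1 : 1 ≤ n := Nat.one_le_floor_iff _ |>.2 hH1
  have hnH : (n : ℝ) ≤ H := Nat.floor_le hH0.le
  have hn1r : (1 : ℝ) ≤ n := by exact_mod_cast hn1
  have hnH2 : H ≤ 2 * n := by linarith [Nat.lt_floor_add_one H]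
  -- With this choice 2κH² is half of (ηH/18)², the lower bound reached in `h4`.
  set κ : ℝ := η ^ 2 / 1296 with hκ
  have hκ0 : 0 < κ := by positivity
  set D : ℝ := 2 * κ * H ^ 2 + H + 1 / (2 * |φ| * κ) with hD
  have hD0 : 0 ≤ D := by positivity
  have hblock : ∀ a b : ℤ, b - a ≤ n → ‖∑ m ∈ Ico a b, expi (θ * m - φ * m ^ 2)‖ ≤ √D := by
    intro a b hab
    refine Real.le_sqrt_of_sq_le (norm_quadratic_sum_sq_le hH0 ?_ hφ0 (by linarith) hκ0)
    have : (b - a : ℝ) ≤ n := by exact_mod_cast hab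
    linarith
  set k := ⌈2 * M / n⌉₊ with hk
  have hk1 : (k : ℝ) ≤ 6 * M / H := by
    have h1 := (Nat.ceil_lt_add_one (show 0 ≤ 2 * M / n by positivity)).le
    have h2 : 2 * M / n ≤ 4 * M / H := by
      rw [div_le_div_iff₀ (by positivity) hH0]
      nlinarith
    have h3 : 1 ≤ 2 * M / H := by
      rw [le_div_iff₀ hH0]
      linarith
    have h4 : 6 * M / H = 4 * M / H + 2 * M / H := by ring
    linarith
  have hk2 : b - a ≤ k * n := by
    have h1 : 2 * M / n ≤ k := Nat.le_ceil _
    rw [div_le_iff₀ (by positivity)] at h1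
    have : (b - a : ℝ) ≤ k * n := by linarith
    exact_mod_cast this
  have h1 := norm_sum_Ico_le_of_blocks _ n (Real.sqrt_nonneg D) hblock k a b hk2
  have h2 : η * M / 3 ≤ 6 * M / H * √D :=
    hS.trans (h1.trans (mul_le_mul_of_nonneg_right hk1 (Real.sqrt_nonneg D)))
  have h3 : η * H / 18 ≤ √D := by
    rw [div_mul_eq_mul_div, le_div_iff₀ hH0] at h2
    have : M * (η * H / 18) ≤ M * √D := by linarith
    exact le_of_mul_le_mul_left this hM0
  have h4 : (η * H / 18) ^ 2 ≤ D := by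
    have := pow_le_pow_left₀ (by positivity) h3 2
    rwa [Real.sq_sqrt hD0] at this
  have h5 : 1 / (2 * |φ| * κ) = 2592 * H / η ^ 2 := by
    rw [hκ, hH]
    field_simp
    norm_num
  rw [hD, h5, hκ] at h4
  have h6 : η ^ 2 * H ^ 2 / 648 ≤ H + 2592 * H / η ^ 2 := by nlinarith
  have h7 : H ≤ H / η ^ 2 := by
    rw [le_div_iff₀ (by positivity)]
    nlinarith [pow_le_one₀ hη.le hη1 (n := 2)]
  have h8 : η ^ 2 * H ^ 2 / 648 ≤ 2593 * H / η ^ 2 := by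
    have : 2593 * H / η ^ 2 = H / η ^ 2 + 2592 * H / η ^ 2 := by ring
    linarith
  rw [le_div_iff₀ (by positivity)] at h8
  have h9 : H * (η ^ 4 * H) ≤ H * 1680264 := by nlinarith
  have h10 := le_of_mul_le_mul_left h9 hH0
  have h11 : M * η ^ 5 ≤ 4 * H * η ^ 4 := by
    calc M * η ^ 5 = (η * M) * η ^ 4 := by ring
      _ ≤ 4 * H * η ^ 4 := by gcongr
  linarith

theorem quadratic_sum_inverse {M η φ θ : ℝ} {a b : ℤ} (hM : 1 ≤ M) (hη : 0 < η) (hη1 : η ≤ 1)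
    (hφ : |φ| * (η * M) ≤ 1) (hab : (b - a : ℝ) ≤ 2 * M)
    (hS : η * M / 3 ≤ ‖∑ m ∈ Ico a b, expi (θ * m - φ * m ^ 2)‖) :
    M * η ^ 5 ≤ 7 * 10 ^ 6 ∨ |φ| * M ^ 2 * η ^ 4 ≤ 2592 := by
  by_cases hφ0 : φ = 0
  · right
    rw [hφ0]
    simp
  have hφp : 0 < |φ| := abs_pos.2 hφ0
  have hM0 : 0 < M := by linarith
  have hη5 : η ^ 5 ≤ η ^ 2 := pow_le_pow_of_le_one hη.le hη1 (by norm_num)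
  have hη51 : η ^ 5 ≤ η := by simpa using pow_le_pow_of_le_one hη.le hη1 (show 1 ≤ 5 by norm_num)
  by_cases hsmall : M * η ^ 5 ≤ 7 * 10 ^ 6
  · exact Or.inl hsmall
  right
  push Not at hsmall
  have hbig2 : 72 ≤ M * η ^ 2 := by nlinarith
  have hbig1 : 4 ≤ M * η := by nlinarith
  by_cases hcase : 8 * M * |φ| ≤ 1
  -- One block of length 2M suffices. The choice of κ makes 2κH² half of (ηM/3)², and `hbig2` lets
  -- the term H = 2M absorb only half of the rest.
  · have h1 := norm_quadratic_sum_sq_le (θ := θ) (κ := η ^ 2 / 144) (H := 2 * M) (by positivity)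
      hab hφ0 (by linarith) (by positivity)
    have h2 : (η * M / 3) ^ 2 ≤ ‖∑ m ∈ Ico a b, expi (θ * m - φ * m ^ 2)‖ ^ 2 := by gcongr
    have h3 : 1 / (2 * |φ| * (η ^ 2 / 144)) = 72 / (|φ| * η ^ 2) := by
      field_simp
      norm_num
    rw [h3] at h1
    have h4 : η ^ 2 * M ^ 2 / 36 ≤ 72 / (|φ| * η ^ 2) := by nlinarith
    rw [le_div_iff₀ (by positivity)] at h4
    linarith
  · exact absurd (quadratic_sum_inverse_of_large_frequency hM0 hη hη1 hφp hφ hab hS hbig1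
      (not_le.1 hcase)) (not_le.2 hsmall)

/-! ### Exponential sums along ⌊√n⌋ -/

/-- Each n is uniquely m² + j with m = ⌊√n⌋ and 0 ≤ j ≤ 2m. Putting j outside makes the inner phase
quadratic in m. -/
theorem sum_Ioc_by_sqrt (f : ℕ → ℕ → ℂ) (a N : ℕ) :
    ∑ n ∈ Ioc a N, f n.sqrt n = ∑ j ∈ range (2 * N.sqrt + 1),
      ∑ m ∈ range (N.sqrt + 1) with j ≤ 2 * m ∧ a < m * m + j ∧ m * m + j ≤ N, f m (m * m + j) := by
  rw [sum_sigma']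
  refine sum_nbij' (fun n => ⟨n - n.sqrt * n.sqrt, n.sqrt⟩) (fun q => q.2 * q.2 + q.1) ?_ ?_ ?_ ?_ ?_
  · intro n hn
    rw [mem_Ioc] at hn
    have h1 := Nat.sqrt_le n
    have h2 := Nat.sqrt_le_add n
    have h3 := Nat.sqrt_le_sqrt hn.2
    simp only [mem_sigma, mem_range, mem_filter]
    omega
  · intro q hq
    simp only [mem_sigma, mem_range, mem_filter] at hq
    rw [mem_Ioc]
    exact ⟨hq.2.2.2.1, hq.2.2.2.2⟩
  · intro n _
    have h1 := Nat.sqrt_le n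
    simp only
    omega
  · rintro ⟨j, m⟩ hq
    simp only [mem_sigma, mem_range, mem_filter] at hq
    have h1 : (m * m + j).sqrt = m := Nat.sqrt_add_eq m (by omega)
    simp [h1]
  · intro n _
    have h1 := Nat.sqrt_le n
    simp only
    congr 1
    omega

theorem sqrt_sum_inverse {N : ℕ} (hN : 1 ≤ N) {η φ θ : ℝ} (hη : 0 < η) (hη1 : η ≤ 1)
    (hφ : |φ| ≤ 1 / 2)
    (hS : η * N ≤ ‖∑ n ∈ Ioc (N / 2) N, expi (θ * n.sqrt - φ * n)‖) :
    N * η ^ 10 ≤ 10 ^ 14 ∨ |φ| * N * η ^ 4 ≤ 2592 := by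
  by_cases hφ0 : φ = 0
  · right
    rw [hφ0]
    simp
  have hφp : 0 < |φ| := abs_pos.2 hφ0
  set s := N.sqrt with hs
  set M : ℝ := √N with hM
  have hM2 : M ^ 2 = N := Real.sq_sqrt (Nat.cast_nonneg N)
  have hM1 : 1 ≤ M := Real.one_le_sqrt.2 (by exact_mod_cast hN)
  have hsM : (s : ℝ) ≤ M := Real.nat_sqrt_le_real_sqrt
  -- A first, weak bound on φ: where ⌊√n⌋ is constant the phase is linear in n, and there are at
  -- most √N + 1 such stretches.
  have hφM : |φ| * (η * M) ≤ 1 := by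
    have h1 : ∑ n ∈ Ioc (N / 2) N, expi (θ * n.sqrt - φ * n) = ∑ m ∈ range (s + 1),
        ∑ n ∈ Ioc (N / 2) N with n.sqrt = m, expi (θ * n.sqrt - φ * n) :=
      (sum_fiberwise_of_maps_to (fun n hn => by
        rw [mem_Ioc] at hn
        rw [mem_range]
        exact Nat.lt_succ_of_le (Nat.sqrt_le_sqrt hn.2)) _).symm
    have h2 : ∀ m ∈ range (s + 1),
        ‖∑ n ∈ Ioc (N / 2) N with n.sqrt = m, expi (θ * n.sqrt - φ * n)‖ ≤ 1 / (2 * |φ|) := by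
      intro m _
      obtain ⟨a, b, hab, -⟩ := exists_eq_Ico
        (((Ioc (N / 2) N).filter (fun n => n.sqrt = m)).map Nat.castEmbedding) (by
          intro x hx y hy z hxz hzy
          simp only [mem_map, mem_filter, mem_Ioc, Nat.castEmbedding_apply] at hx hy ⊢
          obtain ⟨x', ⟨hx1, hx2⟩, rfl⟩ := hx
          obtain ⟨y', ⟨hy1, hy2⟩, rfl⟩ := hy
          lift z to ℕ using by omega
          refine ⟨z, ⟨by omega, ?_⟩, rfl⟩
          have h3 := Nat.sqrt_le_sqrt (show x' ≤ z by omega)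
          have h4 := Nat.sqrt_le_sqrt (show z ≤ y' by omega)
          omega)
      have h3 : ∑ n ∈ Ioc (N / 2) N with n.sqrt = m, expi (θ * n.sqrt - φ * n) =
          expi (θ * m) * ∑ z ∈ Ico a b, expi (-φ * z) := by
        rw [← hab, sum_map, mul_sum]
        refine sum_congr rfl fun n hn => ?_
        rw [(mem_filter.1 hn).2, ← expi_add]
        congr 1
        simp only [Nat.castEmbedding_apply, Int.cast_natCast]
        ring
      rw [h3, norm_mul, norm_expi, one_mul]
      refine (norm_sum_Ico_expi_le (neg_ne_zero.2 hφ0) (by rwa [abs_neg]) a b).trans ?_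
      rw [abs_neg]
    rw [h1] at hS
    have h3 := hS.trans ((norm_sum_le _ _).trans (sum_le_card_nsmul _ _ _ h2))
    rw [card_range, nsmul_eq_mul, mul_one_div, le_div_iff₀ (by positivity)] at h3
    push_cast at h3
    rw [← hM2] at h3
    have h4 : M * (|φ| * (η * M)) ≤ M * 1 := by nlinarith
    exact le_of_mul_le_mul_left h4 (by linarith)
  -- Pigeonhole over the at most 3√N values of j.
  have hj : ∃ j ∈ range (2 * s + 1), η * M / 3 ≤ ‖∑ m ∈ range (s + 1) with
      j ≤ 2 * m ∧ N / 2 < m * m + j ∧ m * m + j ≤ N,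
        expi (θ * m - φ * (m * m + j : ℕ))‖ := by
    by_contra! hcon
    have h1 := sum_Ioc_by_sqrt (fun m n => expi (θ * m - φ * n)) (N / 2) N
    rw [h1] at hS
    have h2 := (norm_sum_le _ _).trans_lt (sum_lt_sum_of_nonempty (by simp) hcon)
    rw [sum_const, card_range, nsmul_eq_mul] at h2
    push_cast at h2
    have h3 : (2 * (s : ℝ) + 1) * (η * M / 3) ≤ 3 * M * (η * M / 3) := by
      gcongr
      linarith
    have h4 : 3 * M * (η * M / 3) = η * N := by rw [← hM2]; ring
    push_cast at hS
    linarith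
  obtain ⟨j, -, hj⟩ := hj
  obtain ⟨a, b, hab, hcard⟩ := exists_eq_Ico
    (((range (s + 1)).filter (fun m => j ≤ 2 * m ∧ N / 2 < m * m + j ∧ m * m + j ≤ N)).map
      Nat.castEmbedding) (by
        intro x hx y hy z hxz hzy
        simp only [mem_map, mem_filter, mem_range, Nat.castEmbedding_apply] at hx hy ⊢
        obtain ⟨x', ⟨hx1, hx2⟩, rfl⟩ := hx
        obtain ⟨y', ⟨hy1, hy2⟩, rfl⟩ := hy
        lift z to ℕ using by omega
        have h3 : x' * x' ≤ z * z := Nat.mul_self_le_mul_self (by omega)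
        have h4 : z * z ≤ y' * y' := Nat.mul_self_le_mul_self (by omega)
        exact ⟨z, ⟨by omega, by omega, by omega, by omega⟩, rfl⟩)
  have h3 : ∑ m ∈ range (s + 1) with j ≤ 2 * m ∧ N / 2 < m * m + j ∧ m * m + j ≤ N,
      expi (θ * m - φ * (m * m + j : ℕ)) =
        expi (-φ * j) * ∑ z ∈ Ico a b, expi (θ * z - φ * z ^ 2) := by
    rw [← hab, sum_map, mul_sum]
    refine sum_congr rfl fun n _ => ?_
    rw [← expi_add]
    congr 1
    simp only [Nat.castEmbedding_apply, Int.cast_natCast]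
    push_cast
    ring
  rw [h3, norm_mul, norm_expi, one_mul] at hj
  have hlen : (b - a : ℝ) ≤ 2 * M := by
    rw [card_map] at hcard
    have h4 := card_filter_le (range (s + 1))
      (fun m => j ≤ 2 * m ∧ N / 2 < m * m + j ∧ m * m + j ≤ N)
    rw [card_range] at h4
    have h5 : b - a ≤ s + 1 := by omega
    have h6 : (b - a : ℝ) ≤ s + 1 := by exact_mod_cast h5
    linarith
  rcases quadratic_sum_inverse hM1 hη hη1 hφM hlen hj with h | h
  · left
    have h4 : (M * η ^ 5) ^ 2 ≤ (7 * 10 ^ 6) ^ 2 := by gcongr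
    rw [mul_pow, hM2, ← pow_mul] at h4
    refine h4.trans ?_
    norm_num
  · right
    rwa [hM2] at h

/-! ### The U² inverse theorem and products over derivatives -/

theorem expi_congr {P : ℕ} (hP : 0 < P) {α l : ℤ} (h : (P : ℤ) ∣ α - l) (x : ℤ) :
    expi (α * x / P) = expi (l * x / P) := by
  obtain ⟨q, hq⟩ := h
  have hPr : (P : ℝ) ≠ 0 := by positivity
  have h1 : (α : ℝ) = l + P * q := by
    have : α = l + P * q := by linarith
    exact_mod_cast this
  rw [h1, show ((l + P * q) * x / P : ℝ) = l * x / P + ((q * x : ℤ) : ℝ) by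
    push_cast
    field_simp, expi_add_intCast]

theorem sum_norm_sq_le_card {ι : Type*} (S : Finset ι) (f : ι → ℂ) (hf : ∀ y, ‖f y‖ ≤ 1) :
    ∑ y ∈ S, ‖f y‖ ^ 2 ≤ #S := by
  refine (sum_le_card_nsmul S _ 1 fun y _ => pow_le_one₀ (norm_nonneg _) (hf y)).trans ?_
  simp

/-- The inverse theorem for the `U²` norm, with a frequency in `P⁻¹ℤ`. -/
theorem exists_frequency {g : ℤ → ℂ} {A P : ℕ} (hP : 4 * A < P) (hg : ∀ y, g y ≠ 0 → |y| ≤ A) :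
    ∃ a : ℤ, ∑ k ∈ Icc (-(2 * A : ℤ)) (2 * A),
      ‖∑ x ∈ Icc (-(A : ℤ)) A, g x * conj (g (x + k))‖ ^ 2 ≤
        ‖∑ x ∈ Icc (-(A : ℤ)) A, g x * expi (a * x / P)‖ ^ 2 *
          ∑ x ∈ Icc (-(A : ℤ)) A, ‖g x‖ ^ 2 := by
  obtain ⟨b, -, hb⟩ := exists_max_image (range P)
    (fun b : ℕ => ‖∑ x ∈ Icc (-(A : ℤ)) A, g x * expi (b * x / P)‖) ⟨0, mem_range.2 (by omega)⟩
  refine ⟨b, ?_⟩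
  -- Up to k ↦ -k, the autocorrelation is the convolution of g with its reflected conjugate; Young's
  -- inequality then brings in the largest Fourier coefficient.
  have h1 := sum_norm_sq_conv_le (Icc (-(A : ℤ)) A) g id (fun y => conj (g (-y))) hP
    (fun n hn => abs_le.2 (mem_Icc.1 hn))
    (fun y hy => by
      have := hg (-y) (fun h0 => hy (by simp [h0]))
      rwa [abs_neg] at this)
    (fun c hc => hb c (mem_range.2 hc))
  have h2 : ∑ y ∈ Icc (-(A : ℤ)) A, ‖conj (g (-y))‖ ^ 2 = ∑ x ∈ Icc (-(A : ℤ)) A, ‖g x‖ ^ 2 :=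
    sum_nbij' (fun y => -y) (fun y => -y) (by simp; omega) (by simp; omega) (by simp) (by simp)
      (by simp)
  have h3 : ∑ k ∈ Icc (-(2 * A : ℤ)) (2 * A),
      ‖∑ x ∈ Icc (-(A : ℤ)) A, g x * conj (g (x + k))‖ ^ 2 =
      ∑ k ∈ Icc (-(2 * A : ℤ)) (2 * A),
        ‖∑ n ∈ Icc (-(A : ℤ)) A, g n * conj (g (-(k - id n)))‖ ^ 2 := by
    refine sum_nbij' (fun y => -y) (fun y => -y) (by simp; omega) (by simp; omega) (by simp)
      (by simp) ?_
    intro k _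
    congr 3
    funext x
    congr 3
    simp only [id]
    ring
  rw [h3]
  rw [h2] at h1
  exact_mod_cast h1

theorem gowersNorm_succ_pow {f : ℤ → ℂ} {A : ℕ} (hf : ∀ y, f y ≠ 0 → |y| ≤ A) (t : ℕ)
    (S : Finset ℤ) (hS : Icc (-(A : ℤ)) A ⊆ S) :
    gowersNorm (t + 1) f ^ (2 ^ (t + 1)) = ∑ h ∈ cube t (Icc (-(2 * A : ℤ)) (2 * A)),
      ‖∑ x ∈ S, iterDiff t h f x‖ ^ 2 := by
  have hfin : f.support.Finite :=
    (Icc (-(A : ℤ)) A).finite_toSet.subset fun y hy => by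
      rw [coe_Icc]
      exact abs_le.1 (hf y hy)
  have h1 := gowersNorm_pow_eq hfin (s := t + 1) (by omega)
  rw [gowersSum_succ hfin] at h1
  have h2 := Complex.ofReal_injective h1
  rw [h2]
  have h3 : ∀ h : Fin t → ℤ, ∑' x, iterDiff t h f x = ∑ x ∈ S, iterDiff t h f x := by
    intro h
    refine tsum_eq_sum fun x hx => ?_
    by_contra hne
    exact hx (hS (mem_Icc.2 (abs_le.1 (hf x (iterDiff_support f t h x hne).1))))
  simp_rw [h3]
  refine tsum_eq_sum fun h hh => ?_
  rw [sum_eq_zero, norm_zero]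
  · norm_num
  · intro x _
    by_contra hne
    obtain ⟨h4, h5⟩ := iterDiff_support f t h x hne
    refine hh (mem_cube.2 fun i => ?_)
    have h6 := abs_le.1 (hf _ h4)
    have h7 := abs_le.1 (hf _ (h5 i))
    rw [mem_Icc]
    omega

theorem norm_iterDiff_le {f : ℤ → ℂ} (hf : ∀ x, ‖f x‖ ≤ 1) (t : ℕ) (h : Fin t → ℤ) (x : ℤ) :
    ‖iterDiff t h f x‖ ≤ ‖f x‖ := by
  induction t generalizing x with
  | zero => exact le_rfl
  | succ t ih =>
    simp only [iterDiff, diffOp]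
    rw [norm_mul, RCLike.norm_conj]
    exact (mul_le_of_le_one_right (norm_nonneg _) ((ih _ _).trans (hf _))).trans (ih _ _)

theorem norm_iterDiff_zero (f : ℤ → ℂ) (x : ℤ) : ∀ t : ℕ, ‖iterDiff t 0 f x‖ = ‖f x‖ ^ (2 ^ t)
  | 0 => by simp [iterDiff]
  | t + 1 => by
    have h1 : iterDiff (t + 1) 0 f x = iterDiff t 0 f x * conj (iterDiff t 0 f x) := by
      simp only [iterDiff, diffOp, Pi.zero_apply, add_zero]
      rfl
    rw [h1, norm_mul, RCLike.norm_conj, norm_iterDiff_zero f x t, pow_succ 2 t, pow_mul, sq]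

theorem iterDiff_zero_eq_norm (f : ℤ → ℂ) (x : ℤ) (t : ℕ) :
    iterDiff (t + 1) 0 f x = ((‖f x‖ ^ (2 ^ (t + 1)) : ℝ) : ℂ) := by
  have h1 : iterDiff (t + 1) 0 f x = iterDiff t 0 f x * conj (iterDiff t 0 f x) := by
    simp only [iterDiff, diffOp, Pi.zero_apply, add_zero]
    rfl
  rw [h1, Complex.mul_conj', norm_iterDiff_zero, pow_succ 2 t, pow_mul, ← Complex.ofReal_pow]

theorem boxProd_one : ∀ (t : ℕ) (h k : Fin t → ℤ), boxProd t (fun _ => 1) h k = 1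
  | 0, _, _ => rfl
  | t + 1, h, k => by
    simp only [boxProd, map_one, mul_one]
    exact boxProd_one t _ _

theorem boxProd_const (t : ℕ) {c : ℂ} (hc : ‖c‖ = 1) (h k : Fin (t + 1) → ℤ) :
    boxProd (t + 1) (fun _ => c) h k = 1 := by
  simp only [boxProd]
  rw [Complex.mul_conj', hc]
  simpa using boxProd_one t _ _

theorem boxProd_expi : ∀ (t : ℕ) (a : (Fin t → ℤ) → ℤ) (y : ℝ) (h k : Fin t → ℤ),
    boxProd t (fun u => expi (a u * y)) h k = expi (altSum t a h k * y)
  | 0, _, _, _, _ => rfl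
  | t + 1, a, y, h, k => by
    simp only [boxProd, altSum]
    rw [← boxProd_expi t]
    congr 1
    funext u
    rw [conj_expi, ← expi_add]
    congr 1
    push_cast
    ring

/-- The derivative is the box product with corner 0; only its top vertex depends on all coordinates
of `k`. -/
theorem iterDiff_eq_conjPow_mul_prod (t : ℕ) {f : ℤ → ℂ} (hf : ∀ x, ‖f x‖ ≤ 1) (x : ℤ) :
    ∃ b : Fin t → (Fin t → ℤ) → ℂ, (∀ i k, ‖b i k‖ ≤ 1) ∧
      (∀ i k v, b i (Function.update k i v) = b i k) ∧
      ∀ k, iterDiff t k f x = conjPow t (f (x + ∑ i, k i)) * ∏ i, b i k := by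
  obtain ⟨b, h1, h2, h3⟩ :=
    boxProd_eq_conjPow_mul_prod t (fun u => f (x + ∑ i, u i)) (fun u => hf _) 0
  refine ⟨b, h1, h2, fun k => ?_⟩
  rw [← h3, boxProd_translate]
  simp

/-- Opening the square gives a sum over `Q ×ˢ Q`, to which the first-moment bound applies; the
resulting box sum folds back into squares. -/
theorem box_lower_bound_sq (H : Finset ℤ) (t : ℕ) {ι : Type} (Q : Finset ι)
    (T : ι → (Fin t → ℤ) → ℂ) (b : ι → Fin t → (Fin t → ℤ) → ℂ) (hb : ∀ q i h, ‖b q i h‖ ≤ 1)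
    (hind : ∀ q i h v, b q i (Function.update h i v) = b q i h) (hQ : Q.Nonempty)
    (hH : H.Nonempty) {ξ : ℝ} (hξ : 0 ≤ ξ)
    (hT : ξ * ((#Q : ℝ) ^ 2 * (#H : ℝ) ^ t) ≤
      ∑ h ∈ cube t H, ‖∑ q ∈ Q, T q h * ∏ i, b q i h‖ ^ 2) :
    ξ ^ (2 ^ t) * ((#Q : ℝ) ^ 2 * (#H : ℝ) ^ (2 * t)) ≤
      ∑ h ∈ cube t H, ∑ k ∈ cube t H, ‖∑ q ∈ Q, boxProd t (T q) h k‖ ^ 2 := by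
  have h1 := box_lower_bound H t (Q ×ˢ Q) (fun z h => T z.1 h * conj (T z.2 h))
    (fun z i h => b z.1 i h * conj (b z.2 i h))
    (fun z i h => by
      rw [norm_mul, RCLike.norm_conj]
      exact mul_le_one₀ (hb _ _ _) (norm_nonneg _) (hb _ _ _))
    (fun z i h v => by simp only [hind]) (hQ.product hQ) hH hξ
  have h2 : ∑ z ∈ Q ×ˢ Q, ∑ h ∈ cube t H, (T z.1 h * conj (T z.2 h)) *
      ∏ i, (b z.1 i h * conj (b z.2 i h)) =
      ((∑ h ∈ cube t H, ‖∑ q ∈ Q, T q h * ∏ i, b q i h‖ ^ 2 : ℝ) : ℂ) := by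
    rw [sum_comm, Complex.ofReal_sum]
    refine sum_congr rfl fun h _ => ?_
    rw [Complex.ofReal_pow, ← Complex.mul_conj', map_sum, sum_mul_sum, ← sum_product']
    refine sum_congr rfl fun z _ => ?_
    rw [map_mul, map_prod, prod_mul_distrib]
    ring
  have h3 : ∑ z ∈ Q ×ˢ Q, ∑ h ∈ cube t H, ∑ k ∈ cube t H,
      boxProd t (fun h => T z.1 h * conj (T z.2 h)) h k =
      ((∑ h ∈ cube t H, ∑ k ∈ cube t H, ‖∑ q ∈ Q, boxProd t (T q) h k‖ ^ 2 : ℝ) : ℂ) := by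
    rw [sum_comm, Complex.ofReal_sum]
    refine sum_congr rfl fun h _ => ?_
    rw [sum_comm, Complex.ofReal_sum]
    refine sum_congr rfl fun k _ => ?_
    rw [Complex.ofReal_pow, ← Complex.mul_conj', map_sum, sum_mul_sum, ← sum_product']
    refine sum_congr rfl fun z _ => ?_
    rw [boxProd_mul, boxProd_conj]
  have h4 : (0 : ℝ) ≤ ∑ h ∈ cube t H, ‖∑ q ∈ Q, T q h * ∏ i, b q i h‖ ^ 2 :=
    sum_nonneg fun _ _ => sq_nonneg _
  have h5 : (0 : ℝ) ≤ ∑ h ∈ cube t H, ∑ k ∈ cube t H, ‖∑ q ∈ Q, boxProd t (T q) h k‖ ^ 2 :=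
    sum_nonneg fun _ _ => sum_nonneg fun _ _ => sq_nonneg _
  rw [h2, h3, Complex.norm_real, Complex.norm_real, Real.norm_of_nonneg h4,
    Real.norm_of_nonneg h5, card_product] at h1
  rw [Nat.cast_mul, ← sq (#Q : ℝ)] at h1
  exact h1 hT

/-! ### The bilinear form with a linear phase -/

/-- The form `∑ e(αx/P) g₀(x + n) g₁(x - ⌊√n⌋ + n)` over `x ∈ J` and `N/2 < n ≤ N`. -/
noncomputable def phaseForm (J : Finset ℤ) (N P : ℕ) (g₀ g₁ : ℤ → ℂ) (α : ℤ) : ℂ :=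
  ∑ q ∈ J ×ˢ Ioc (N / 2) N,
    g₀ (q.1 + q.2) * g₁ (q.1 - q.2.sqrt + q.2) * expi (α * q.1 / P)

/-- The substitution y = x + n exhibits the sum over n as g₁ convolved with weights e(-αn/P) placed
at ⌊√n⌋. -/
theorem phaseForm_eq {N A P : ℕ} {g₀ g₁ : ℤ → ℂ} (hNA : N ≤ A) (hs₀ : ∀ y, g₀ y ≠ 0 → |y| ≤ A)
    (α : ℤ) : phaseForm (Icc (-(2 * A : ℤ)) (2 * A)) N P g₀ g₁ α =
      ∑ y ∈ Icc (-(A : ℤ)) A, g₀ y * expi (α * y / P) *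
        ∑ n ∈ Ioc (N / 2) N, expi (-(α * n / P)) * g₁ (y - n.sqrt) := by
  simp_rw [mul_sum]
  rw [phaseForm, sum_product, sum_comm, sum_comm (s := Icc (-(A : ℤ)) A)]
  refine sum_congr rfl fun n hn => ?_
  rw [mem_Ioc] at hn
  rw [← sum_sub_eq_sum (fun y => g₀ y * expi (α * y / P) *
    (expi (-(α * n / P)) * g₁ (y - n.sqrt))) (Icc (-(2 * A : ℤ)) (2 * A)) (Icc (-(A : ℤ)) A) (-n)]
  · refine sum_congr rfl fun x _ => ?_
    simp only [sub_neg_eq_add]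
    rw [show (α * x / P : ℝ) = α * ((x + n : ℤ) : ℝ) / P + -(α * n / P) by push_cast; ring,
      expi_add, show x - (n.sqrt : ℤ) + n = x + n - n.sqrt by ring]
    ring
  · intro y hy
    have h1 := abs_le.1 (hs₀ y (left_ne_zero_of_mul (left_ne_zero_of_mul hy)))
    simp only [mem_Icc]
    omega

/-- Cauchy–Schwarz in y discards g₀ and Young's inequality discards g₁, leaving a large Fourier
coefficient of the weights e(-αn/P) at ⌊√n⌋. -/
theorem phaseForm_inverse {N A P : ℕ} {g₀ g₁ : ℤ → ℂ} (hN : 1 ≤ N) (hNA : N ≤ A) (hP : 4 * A < P)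
    (hg₀ : ∀ y, ‖g₀ y‖ ≤ 1) (hg₁ : ∀ y, ‖g₁ y‖ ≤ 1) (hs₀ : ∀ y, g₀ y ≠ 0 → |y| ≤ A)
    (hs₁ : ∀ y, g₁ y ≠ 0 → |y| ≤ A) (α : ℤ) {η : ℝ} (hη : 0 < η) (hη1 : η ≤ 1)
    (h : η * N * (2 * A + 1) < ‖phaseForm (Icc (-(2 * A : ℤ)) (2 * A)) N P g₀ g₁ α‖) :
    N * η ^ 10 ≤ 10 ^ 14 ∨ ∃ l : ℤ, (P : ℤ) ∣ α - l ∧ |(l : ℝ)| * N * η ^ 4 ≤ 2592 * P := by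
  have hP0 : 0 < P := by omega
  have hPr : (0 : ℝ) < P := by exact_mod_cast hP0
  -- The balanced residue makes |l/P| ≤ 1/2, as the exponential sum estimate requires.
  set l := Int.bmod α P with hl
  have hdvd : (P : ℤ) ∣ α - l := by
    have h1 : l % P = α % P := Int.bmod_emod
    exact Int.ModEq.dvd h1
  have hl2 : |2 * l| ≤ P := by
    have h1 := Int.le_bmod (x := α) hP0
    have h2 := Int.bmod_lt (x := α) hP0
    rw [abs_le]
    omega
  have hb : ∃ b < P, η * N < ‖∑ n ∈ Ioc (N / 2) N, expi (-(α * n / P)) *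
      expi (b * ((n.sqrt : ℤ) : ℝ) / P)‖ := by
    by_contra! hcon
    have h1 := sum_norm_sq_conv_le (Ioc (N / 2) N) (fun n => expi (-(α * n / P)))
      (fun n => (n.sqrt : ℤ)) g₁ hP (fun n hn => by
        have h2 := Nat.sqrt_le_self n
        rw [mem_Ioc] at hn
        rw [abs_le]
        omega) hs₁ hcon
    have h2 := sum_norm_sq_le_card (Icc (-(A : ℤ)) A) g₁ hg₁
    have hcard : (#(Icc (-(A : ℤ)) A) : ℝ) = 2 * A + 1 := by
      rw [Int.card_Icc, show (A + 1 - -A : ℤ).toNat = 2 * A + 1 by omega]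
      push_cast
      ring
    rw [hcard] at h2
    rw [phaseForm_eq hNA hs₀] at h
    set v : ℤ → ℂ := fun y => ∑ n ∈ Ioc (N / 2) N, expi (-(α * n / P)) * g₁ (y - n.sqrt) with hv
    have h3 : ‖∑ y ∈ Icc (-(A : ℤ)) A, g₀ y * expi (α * y / P) * v y‖ ≤
        ∑ y ∈ Icc (-(A : ℤ)) A, ‖v y‖ := by
      refine (norm_sum_le _ _).trans (sum_le_sum fun y _ => ?_)
      rw [norm_mul, norm_mul, norm_expi, mul_one]
      exact mul_le_of_le_one_left (norm_nonneg _) (hg₀ y)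
    have h4 : (∑ y ∈ Icc (-(A : ℤ)) A, ‖v y‖) ^ 2 ≤
        (2 * A + 1) * ∑ y ∈ Icc (-(A : ℤ)) A, ‖v y‖ ^ 2 := by
      rw [← hcard]
      exact sq_sum_le_card_mul_sum_sq
    have h5 : ∑ y ∈ Icc (-(A : ℤ)) A, ‖v y‖ ^ 2 ≤
        ∑ y ∈ Icc (-(2 * A : ℤ)) (2 * A), ‖v y‖ ^ 2 :=
      sum_le_sum_of_subset_of_nonneg (Icc_subset_Icc (by omega) (by omega))
        fun _ _ _ => by positivity
    have h6 : ∑ y ∈ Icc (-(2 * A : ℤ)) (2 * A), ‖v y‖ ^ 2 ≤ (η * N) ^ 2 * (2 * A + 1) :=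
      h1.trans (by gcongr)
    have h7 : (∑ y ∈ Icc (-(A : ℤ)) A, ‖v y‖) ^ 2 ≤ (η * N * (2 * A + 1)) ^ 2 := by
      refine h4.trans ((mul_le_mul_of_nonneg_left (h5.trans h6) (by positivity)).trans ?_)
      exact le_of_eq (by ring)
    have h8 := le_of_sq_le_sq h7 (by positivity)
    linarith
  obtain ⟨b, -, hb⟩ := hb
  have h1 : ∑ n ∈ Ioc (N / 2) N, expi (-(α * n / P)) * expi (b * ((n.sqrt : ℤ) : ℝ) / P) =
      ∑ n ∈ Ioc (N / 2) N, expi ((b / P : ℝ) * n.sqrt - (l / P : ℝ) * n) := by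
    refine sum_congr rfl fun n _ => ?_
    have h2 := expi_congr hP0 hdvd n
    rw [← conj_expi]
    rw [Int.cast_natCast] at h2
    rw [h2, conj_expi, ← expi_add]
    congr 1
    push_cast
    ring
  rw [h1] at hb
  have hlP : |(l / P : ℝ)| ≤ 1 / 2 := by
    rw [abs_div, abs_of_pos hPr, div_le_iff₀ hPr]
    have : (|2 * l| : ℝ) ≤ P := by exact_mod_cast hl2
    rw [abs_mul, abs_two] at this
    linarith
  rcases sqrt_sum_inverse hN hη hη1 hlP hb.le with h2 | h2
  · exact Or.inl h2
  · refine Or.inr ⟨l, hdvd, ?_⟩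
    rw [abs_div, abs_of_pos hPr] at h2
    have h3 : |(l : ℝ)| / P * N * η ^ 4 = |(l : ℝ)| * N * η ^ 4 / P := by ring
    rwa [h3, div_le_iff₀ hPr] at h2

/-! ### Dual functions and dual–difference interchange -/

theorem dualFun_eq {N : ℕ} (f₀ f₁ : ℤ → ℂ) (x : ℤ) : dualFun N f₀ f₁ x =
    (1 / (N : ℂ)) * ∑ n ∈ Ioc (N / 2) N, f₀ (x + n) * f₁ (x - n.sqrt + n) := by
  rw [dualFun, ← sum_filter]
  congr 1
  refine sum_congr ?_ fun n _ => ?_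
  · ext n
    rw [mem_filter, mem_Icc, mem_Ioc]
    have h1 : (N : ℝ) / 2 < n ↔ N < 2 * n := by
      rw [div_lt_iff₀ two_pos, mul_comm]
      exact_mod_cast Iff.rfl
    rw [h1]
    omega
  · rw [Real.floor_real_sqrt_eq_nat_sqrt]

theorem norm_dualFun_le {N : ℕ} (hN : 1 ≤ N) {f₀ f₁ : ℤ → ℂ} (h₀ : ∀ x, ‖f₀ x‖ ≤ 1)
    (h₁ : ∀ x, ‖f₁ x‖ ≤ 1) (x : ℤ) : ‖dualFun N f₀ f₁ x‖ ≤ 1 := by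
  have hNr : (0 : ℝ) < N := by exact_mod_cast hN
  have h2 : ‖∑ n ∈ Ioc (N / 2) N, f₀ (x + n) * f₁ (x - n.sqrt + n)‖ ≤ N := by
    refine (norm_sum_le _ _).trans ((sum_le_card_nsmul _ _ 1 fun n _ => ?_).trans ?_)
    · rw [norm_mul]
      exact mul_le_one₀ (h₀ _) (norm_nonneg _) (h₁ _)
    · rw [nsmul_eq_mul, mul_one, Nat.card_Ioc]
      exact_mod_cast Nat.sub_le _ _
  rw [dualFun_eq, norm_mul, norm_div, norm_one, Complex.norm_natCast, one_div,
    inv_mul_le_iff₀ hNr, mul_one]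
  exact h2

theorem dualFun_support {N V : ℕ} {f₀ f₁ : ℤ → ℂ} (hs₀ : ∀ y, f₀ y ≠ 0 → |y| ≤ V) (x : ℤ)
    (hx : dualFun N f₀ f₁ x ≠ 0) : |x| ≤ V + N := by
  rw [dualFun_eq] at hx
  obtain ⟨n, hn, hne⟩ := exists_ne_zero_of_sum_ne_zero (right_ne_zero_of_mul hx)
  have h1 := abs_le.1 (hs₀ _ (left_ne_zero_of_mul hne))
  rw [mem_Ioc] at hn
  rw [abs_le]
  omega

theorem abs_sum_le_of_mem_cube {t W : ℕ} {h : Fin t → ℤ}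
    (hh : h ∈ cube t (Icc (-(2 * W : ℤ)) (2 * W))) : |∑ i, h i| ≤ 2 * t * W := by
  refine (abs_sum_le_sum_abs _ _).trans ?_
  refine (sum_le_card_nsmul univ _ (2 * W : ℤ) fun i _ => ?_).trans ?_
  · exact abs_le.2 (mem_Icc.1 (mem_cube.1 hh i))
  · simp only [card_univ, Fintype.card_fin, nsmul_eq_mul]
    exact le_of_eq (by ring)

/-- Dual–difference interchange: many cubes carry a large bilinear form with a linear phase. -/
theorem card_large_phaseForm {t N : ℕ} (hN : 1 ≤ N) {H J : Finset ℤ} (hH : H.Nonempty)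
    (hJ : J.Nonempty) (P : ℕ) {f₀ f₁ : ℤ → ℂ} (hf₀ : ∀ x, ‖f₀ x‖ ≤ 1) (hf₁ : ∀ x, ‖f₁ x‖ ≤ 1)
    (a : (Fin t → ℤ) → ℤ) {E : Finset (Fin t → ℤ)} (hE : E ⊆ cube t H) {ξ : ℝ} (hξ : 0 ≤ ξ)
    (hS : ξ * ((#J : ℝ) ^ 2 * (#H : ℝ) ^ t) ≤
      ∑ h ∈ E, ‖∑ x ∈ J, iterDiff t h (dualFun N f₀ f₁) x * expi (a h * x / P)‖ ^ 2) :
    ξ ^ (2 ^ t) / 2 * (#H : ℝ) ^ (2 * t) ≤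
      #((cube t H ×ˢ cube t H).filter fun z => z.2 ∈ E ∧
        ξ ^ (2 ^ t) / 2 * ((#J : ℝ) * #(Ioc (N / 2) N)) ^ 2 ≤ ‖phaseForm J N P
          (fun y => boxProd t (fun u => conjPow t (f₀ (y + ∑ i, u i))) z.1 z.2)
          (fun y => boxProd t (fun u => conjPow t (f₁ (y + ∑ i, u i))) z.1 z.2)
          (altSum t a z.1 z.2)‖ ^ 2) := by
  classical
  have hNr : (0 : ℝ) < N := by exact_mod_cast hN
  have hNc : (N : ℂ) ≠ 0 := by exact_mod_cast hNr.ne'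
  set Λ := Ioc (N / 2) N with hΛ
  have hΛne : Λ.Nonempty := ⟨N, by rw [hΛ, mem_Ioc]; omega⟩
  have hΛN : (#Λ : ℝ) ≤ N := by
    rw [hΛ, Nat.card_Ioc]
    exact_mod_cast Nat.sub_le _ _
  set F := dualFun N f₀ f₁ with hF
  have hFle : ∀ x, ‖F x‖ ≤ 1 := norm_dualFun_le hN hf₀ hf₁
  choose b hb1 hb2 hb3 using iterDiff_eq_conjPow_mul_prod t hFle
  -- The indicator of `E` goes inside `T`, so that sums run over the full cube; its box product
  -- vanishes unless both corners lie in `E`.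
  set w : (Fin t → ℤ) → ℂ := fun u => if u ∈ E then 1 else 0 with hw
  set T : ℤ × ℕ → (Fin t → ℤ) → ℂ := fun q u => w u * (conjPow t (f₀ (q.1 + q.2 + ∑ i, u i)) *
    conjPow t (f₁ (q.1 - q.2.sqrt + q.2 + ∑ i, u i)) * expi (a u * (q.1 / P))) with hT
  set g : (ℤ → ℂ) → (Fin t → ℤ) × (Fin t → ℤ) → ℤ → ℂ := fun f z y =>
    boxProd t (fun u => conjPow t (f (y + ∑ i, u i))) z.1 z.2 with hg
  have hsum : ∀ h ∈ cube t H, ‖∑ q ∈ J ×ˢ Λ, T q h * ∏ i, b q.1 i h‖ ^ 2 =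
      if h ∈ E then N ^ 2 * ‖∑ x ∈ J, iterDiff t h F x * expi (a h * x / P)‖ ^ 2 else 0 := by
    intro h _
    split_ifs with hh
    · have h1 : ∑ q ∈ J ×ˢ Λ, T q h * ∏ i, b q.1 i h =
          N * ∑ x ∈ J, iterDiff t h F x * expi (a h * x / P) := by
        rw [sum_product, mul_sum]
        refine sum_congr rfl fun x _ => ?_
        rw [hb3 x h, hF, dualFun_eq, map_mul, map_sum, map_div₀, map_one, map_natCast, mul_sum,
          sum_mul, sum_mul, mul_sum]
        refine sum_congr rfl fun n _ => ?_
        simp only [hT, hw, if_pos hh, map_mul]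
        rw [show x + (n : ℤ) + ∑ i, h i = x + ∑ i, h i + n by ring,
          show x - (n.sqrt : ℤ) + n + ∑ i, h i = x + ∑ i, h i - n.sqrt + n by ring, mul_div_assoc]
        field_simp
      rw [h1, norm_mul, mul_pow, Complex.norm_natCast]
    · rw [sum_eq_zero, norm_zero, zero_pow two_ne_zero]
      intro q _
      simp [hT, hw, if_neg hh]
  have hbig := box_lower_bound_sq H t (J ×ˢ Λ) T (fun q => b q.1) (fun q => hb1 q.1)
    (fun q => hb2 q.1) (hJ.product hΛne) hH hξ (by
      rw [sum_congr rfl hsum, ← sum_filter, filter_mem_eq_inter, inter_eq_right.2 hE, ← mul_sum,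
        card_product, Nat.cast_mul]
      calc ξ * (((#J : ℝ) * #Λ) ^ 2 * (#H : ℝ) ^ t)
          = (#Λ : ℝ) ^ 2 * (ξ * ((#J : ℝ) ^ 2 * (#H : ℝ) ^ t)) := by ring
        _ ≤ (N : ℝ) ^ 2 * (ξ * ((#J : ℝ) ^ 2 * (#H : ℝ) ^ t)) := by gcongr
        _ ≤ _ := by gcongr)
  have hbox : ∀ z ∈ cube t H ×ˢ cube t H, ‖∑ q ∈ J ×ˢ Λ, boxProd t (T q) z.1 z.2‖ ^ 2 ≤
      if z.2 ∈ E then ‖phaseForm J N P (g f₀ z) (g f₁ z) (altSum t a z.1 z.2)‖ ^ 2 else 0 := by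
    intro z _
    have h1 : ∑ q ∈ J ×ˢ Λ, boxProd t (T q) z.1 z.2 =
        boxProd t w z.1 z.2 * phaseForm J N P (g f₀ z) (g f₁ z) (altSum t a z.1 z.2) := by
      rw [phaseForm, mul_sum]
      refine sum_congr rfl fun q _ => ?_
      simp only [hT, hg]
      rw [boxProd_mul, boxProd_mul, boxProd_mul, boxProd_expi, mul_div_assoc]
    rw [h1]
    have hw1 : ∀ u, ‖w u‖ ≤ 1 := by
      intro u
      simp only [hw]
      split_ifs <;> simp
    split_ifs with hz
    · rw [norm_mul, mul_pow]
      exact mul_le_of_le_one_left (by positivity)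
        (pow_le_one₀ (norm_nonneg _) (boxProd_norm_le t w hw1 _ _))
    · have h2 : boxProd t w z.1 z.2 = 0 := by
        by_contra hne
        exact (boxProd_ne_zero t w _ _ hne).2 (if_neg hz)
      rw [h2, zero_mul, norm_zero]
      norm_num
  set ζ : ℝ := ξ ^ (2 ^ t) / 2 with hζ
  have hζ0 : 0 ≤ ζ := by positivity
  set M : ℝ := (#J : ℝ) * #Λ with hM
  have hM0 : 0 < M := by
    have h1 : (0 : ℝ) < #J := by exact_mod_cast hJ.card_pos
    have h2 : (0 : ℝ) < #Λ := by exact_mod_cast hΛne.card_pos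
    positivity
  set G := (cube t H ×ˢ cube t H).filter fun z => z.2 ∈ E ∧
    ζ * M ^ 2 ≤ ‖phaseForm J N P (g f₀ z) (g f₁ z) (altSum t a z.1 z.2)‖ ^ 2 with hG
  have hgle : ∀ f : ℤ → ℂ, (∀ x, ‖f x‖ ≤ 1) → ∀ z y, ‖g f z y‖ ≤ 1 := by
    intro f hf z y
    refine boxProd_norm_le t _ (fun u => ?_) _ _
    rw [norm_conjPow]
    exact hf _
  have hform : ∀ z, ‖phaseForm J N P (g f₀ z) (g f₁ z) (altSum t a z.1 z.2)‖ ≤ M := by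
    intro z
    refine (norm_sum_le _ _).trans ((sum_le_card_nsmul _ _ 1 fun q _ => ?_).trans ?_)
    · rw [norm_mul, norm_mul, norm_expi, mul_one]
      exact mul_le_one₀ (hgle _ hf₀ _ _) (norm_nonneg _) (hgle _ hf₁ _ _)
    · rw [nsmul_eq_mul, mul_one, card_product, Nat.cast_mul]
  -- Popularity: pairs outside `G` contribute at most half of the lower bound `hbig`, and each pair
  -- in `G` at most M².
  have hpt : ∀ z ∈ cube t H ×ˢ cube t H, ‖∑ q ∈ J ×ˢ Λ, boxProd t (T q) z.1 z.2‖ ^ 2 ≤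
      (if z ∈ G then M ^ 2 else 0) + ζ * M ^ 2 := by
    intro z hz
    refine (hbox z hz).trans ?_
    split_ifs with h1 h2 h2
    · have := pow_le_pow_left₀ (norm_nonneg _) (hform z) 2
      have h3 : 0 ≤ ζ * M ^ 2 := by positivity
      linarith
    · rw [zero_add]
      by_contra! hcon
      exact h2 (mem_filter.2 ⟨hz, h1, hcon.le⟩)
    · positivity
    · positivity
  have hsumle := sum_le_sum hpt
  rw [sum_add_distrib, ← sum_filter, filter_mem_eq_inter, inter_eq_right.2 (filter_subset _ _),
    sum_const, sum_const, card_product, card_cube, nsmul_eq_mul, nsmul_eq_mul, sum_product]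
    at hsumle
  rw [card_product, Nat.cast_mul, ← hM] at hbig
  have h1 : ξ ^ (2 ^ t) = 2 * ζ := by rw [hζ]; ring
  rw [h1] at hbig
  push_cast at hsumle
  have h2 := hbig.trans hsumle
  have h3 : M ^ 2 * (ζ * (#H : ℝ) ^ (2 * t)) ≤ M ^ 2 * #G := by
    have h4 : (#H : ℝ) ^ t * (#H : ℝ) ^ t = (#H : ℝ) ^ (2 * t) := by ring
    rw [h4] at h2
    linarith
  exact le_of_mul_le_mul_left h3 (pow_pos hM0 2)

theorem boxProd_support {t W : ℕ} {f : ℤ → ℂ} (hf : ∀ y, f y ≠ 0 → |y| ≤ W) {h k : Fin t → ℤ}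
    (hh : h ∈ cube t (Icc (-(2 * W : ℤ)) (2 * W))) (y : ℤ)
    (hy : boxProd t (fun u => conjPow t (f (y + ∑ i, u i))) h k ≠ 0) :
    |y| ≤ ((2 * t + 1) * W : ℕ) := by
  have h1 := (boxProd_ne_zero t _ _ _ hy).1
  have h2 := hf (y + ∑ i, h i) (fun h0 => h1 (by
    show conjPow t (f (y + ∑ i, h i)) = 0
    rw [h0, map_zero]))
  have h3 := abs_sum_le_of_mem_cube hh
  rw [abs_le] at h2 h3 ⊢
  push_cast
  constructor <;> linarith

open scoped Classical in
/-- The alternating sums of the frequencies of the differenced dual function are often close to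
integers. -/
theorem card_small_altSum {t N W P : ℕ} (hN : 1 ≤ N) (hNW : N ≤ W)
    (hP : 4 * ((2 * t + 1) * W) < P) {H J : Finset ℤ} (hH : H = Icc (-(2 * W : ℤ)) (2 * W))
    (hJ : J = Icc (-(2 * ((2 * t + 1) * W : ℕ) : ℤ)) (2 * ((2 * t + 1) * W : ℕ)))
    {f₀ f₁ : ℤ → ℂ} (hf₀ : ∀ x, ‖f₀ x‖ ≤ 1) (hf₁ : ∀ x, ‖f₁ x‖ ≤ 1)
    (hs₀ : ∀ y, f₀ y ≠ 0 → |y| ≤ W) (hs₁ : ∀ y, f₁ y ≠ 0 → |y| ≤ W)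
    (a : (Fin t → ℤ) → ℤ) {E : Finset (Fin t → ℤ)} (hE : E ⊆ cube t H) {ξ η : ℝ} (hξ : 0 < ξ)
    (hξ1 : ξ ≤ 1) (hη : η = ξ ^ (2 ^ t) / 4) (hlarge : 10 ^ 14 < N * η ^ 10)
    (hS : ξ * ((#J : ℝ) ^ 2 * (#H : ℝ) ^ t) ≤
      ∑ h ∈ E, ‖∑ x ∈ J, iterDiff t h (dualFun N f₀ f₁) x * expi (a h * x / P)‖ ^ 2) :
    2 * η * (#H : ℝ) ^ (2 * t) ≤ #((cube t H ×ˢ cube t H).filter fun z => z.2 ∈ E ∧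
      ∃ l : ℤ, (P : ℤ) ∣ altSum t a z.1 z.2 - l ∧ |(l : ℝ)| * N * η ^ 4 ≤ 2592 * P) := by
  classical
  have hNr : (0 : ℝ) < N := by exact_mod_cast hN
  set A := (2 * t + 1) * W with hA
  have hWA : W ≤ A := Nat.le_mul_of_pos_left W (by omega)
  have hη0 : 0 < η := by rw [hη]; positivity
  have hξp : ξ ^ (2 ^ t) ≤ 1 := pow_le_one₀ hξ.le hξ1
  have hη2 : ξ ^ (2 ^ t) / 2 = 2 * η := by rw [hη]; ring
  have hcount := card_large_phaseForm hN (H := H) (J := J) ⟨0, by rw [hH, mem_Icc]; omega⟩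
    ⟨0, by rw [hJ, mem_Icc]; omega⟩ P hf₀ hf₁ a hE hξ.le hS
  rw [hη2] at hcount
  refine hcount.trans ?_
  rw [Nat.cast_le]
  refine card_le_card fun z hz => ?_
  obtain ⟨hzc, hzE, hz2⟩ := mem_filter.1 hz
  refine mem_filter.2 ⟨hzc, hzE, ?_⟩
  have hz1 : z.1 ∈ cube t (Icc (-(2 * W : ℤ)) (2 * W)) := hH ▸ (mem_product.1 hzc).1
  have hJcard : (#J : ℝ) = 4 * A + 1 := by
    rw [hJ, Int.card_Icc, show (2 * (A : ℤ) + 1 - -(2 * A)).toNat = 4 * A + 1 by omega]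
    push_cast
    ring
  have hΛcard : (N : ℝ) / 2 ≤ #(Ioc (N / 2) N) := by
    rw [Nat.card_Ioc, div_le_iff₀ two_pos]
    have : N ≤ (N - N / 2) * 2 := by omega
    exact_mod_cast this
  have hA0 : (0 : ℝ) < A := by
    have : 0 < A := by omega
    exact_mod_cast this
  have h1 : η * N * (2 * A + 1) < 2 * η * ((#J : ℝ) * #(Ioc (N / 2) N)) := by
    rw [hJcard]
    calc η * N * (2 * A + 1) < η * N * (4 * A + 1) := by gcongr; norm_num
      _ = 2 * η * ((4 * A + 1) * (N / 2)) := by ring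
      _ ≤ _ := by gcongr
  -- Since 2η ≤ 1, its square may replace it, which allows the square root to be taken without
  -- fractional powers of η.
  have h2 : (2 * η * ((#J : ℝ) * #(Ioc (N / 2) N))) ^ 2 ≤
      2 * η * ((#J : ℝ) * #(Ioc (N / 2) N)) ^ 2 := by
    rw [mul_pow]
    gcongr
    nlinarith
  have h3 := le_of_sq_le_sq (h2.trans hz2) (norm_nonneg _)
  rw [hJ] at h1 h3
  have h4 := phaseForm_inverse hN (hNW.trans hWA) hP
    (fun y => boxProd_norm_le t _ (fun u => by rw [norm_conjPow]; exact hf₀ _) z.1 z.2)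
    (fun y => boxProd_norm_le t _ (fun u => by rw [norm_conjPow]; exact hf₁ _) z.1 z.2)
    (boxProd_support hs₀ hz1) (boxProd_support hs₁ hz1) (altSum t a z.1 z.2) hη0
    (by rw [hη]; linarith) (h1.trans_le h3)
  exact h4.resolve_left (not_le.2 hlarge)

/-! ### Low-rank frequencies and the lower Gowers norm -/

/-- Pigeonhole over the pairs (h, l), with 2Q + 1 choices of l. On one fibre h is fixed, so
projecting to the second corner is injective. -/
theorem exists_common_altSum {t P Q : ℕ} {H : Finset ℤ} (hH : H.Nonempty)
    (a : (Fin t → ℤ) → ℤ) {E : Finset (Fin t → ℤ)} {ζ : ℝ}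
    {G : Finset ((Fin t → ℤ) × (Fin t → ℤ))} (hG : G ⊆ cube t H ×ˢ cube t H)
    (hGE : ∀ z ∈ G, z.2 ∈ E ∧ ∃ l : ℤ, (P : ℤ) ∣ altSum t a z.1 z.2 - l ∧ |l| ≤ Q)
    (hcard : ζ * (#H : ℝ) ^ (2 * t) ≤ #G) :
    ∃ (h : Fin t → ℤ) (l : ℤ), ∃ E' ⊆ E, (∀ k ∈ E', (P : ℤ) ∣ altSum t a h k - l) ∧
      ζ / (2 * Q + 1) * (#H : ℝ) ^ t ≤ #E' := by
  classical
  have hc : (0 : ℝ) < #H := by exact_mod_cast hH.card_pos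
  choose! l hl using fun z hz => (hGE z hz).2
  obtain ⟨y, -, hy⟩ := exists_le_card_fiber_of_nsmul_le_card_of_maps_to (s := G)
    (t := cube t H ×ˢ Icc (-(Q : ℤ)) Q) (f := fun z => (z.1, l z))
    (b := ζ / (2 * Q + 1) * (#H : ℝ) ^ t)
    (fun z hz => mem_product.2 ⟨(mem_product.1 (hG hz)).1, mem_Icc.2 (abs_le.1 (hl z hz).2)⟩)
    (by
      obtain ⟨u, hu⟩ := hH
      exact ⟨(fun _ => u, 0), mem_product.2 ⟨mem_cube.2 fun _ => hu, mem_Icc.2 (by omega)⟩⟩)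
    (by
      refine le_trans (le_of_eq ?_) hcard
      rw [card_product, card_cube, Int.card_Icc,
        show ((Q : ℤ) + 1 - -Q).toNat = 2 * Q + 1 by omega, nsmul_eq_mul]
      push_cast
      field_simp
      ring)
  refine ⟨y.1, y.2, (G.filter fun z => (z.1, l z) = y).image Prod.snd, ?_, ?_, ?_⟩
  · intro k hk
    obtain ⟨z, hz, rfl⟩ := mem_image.1 hk
    exact (hGE z (mem_filter.1 hz).1).1
  · intro k hk
    obtain ⟨z, hz, rfl⟩ := mem_image.1 hk
    obtain ⟨hzG, hzy⟩ := mem_filter.1 hz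
    rw [← hzy]
    exact (hl z hzG).1
  · rw [card_image_of_injOn]
    · exact hy
    · intro z hz z' hz' hzz
      have h1 := (mem_filter.1 hz).2
      have h2 := (mem_filter.1 hz').2
      exact Prod.ext (Prod.mk.inj (h1.trans h2.symm)).1 hzz

/-- Large Fourier coefficients of the derivatives of `f` at low-rank frequencies force a large
Gowers norm of one degree less. -/
theorem gowersNorm_lower_bound {t W P : ℕ} (ht : 1 ≤ t) (hP : 0 < P) {H J : Finset ℤ}
    (hH : H = Icc (-(2 * W : ℤ)) (2 * W))
    (hJ : Icc (-((2 * t + 1) * W : ℕ) : ℤ) ((2 * t + 1) * W : ℕ) ⊆ J)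
    {f : ℤ → ℂ} (hf : ∀ x, ‖f x‖ ≤ 1) (hs : ∀ y, f y ≠ 0 → |y| ≤ W)
    (a : (Fin t → ℤ) → ℤ) {E : Finset (Fin t → ℤ)} (hE : E ⊆ cube t H) (h₀ : Fin t → ℤ) (l : ℤ)
    (hl : ∀ k ∈ E, (P : ℤ) ∣ altSum t a h₀ k - l) {ξ : ℝ} (hξ : 0 ≤ ξ)
    (hS : ξ * ((#J : ℝ) ^ 2 * (#H : ℝ) ^ t) ≤
      ∑ h ∈ E, ‖∑ x ∈ J, iterDiff t h f x * expi (a h * x / P)‖ ^ 2) :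
    ξ ^ (2 ^ t) * ((#J : ℝ) ^ 2 * (#H : ℝ) ^ t) ≤ gowersNorm (t + 1) f ^ (2 ^ (t + 1)) := by
  have hHne : H.Nonempty := ⟨0, by rw [hH, mem_Icc]; omega⟩
  have hJne : J.Nonempty := ⟨0, hJ (by rw [mem_Icc]; omega)⟩
  choose b hb1 hb2 hb3 using iterDiff_eq_conjPow_mul_prod t hf
  choose c hc1 hc2 hc3 using fun x : ℤ => boxProd_eq_conjPow_mul_prod t
    (fun u => expi (a u * (x / P : ℝ))) (fun u => (norm_expi _).le) h₀
  set T : ℤ → (Fin t → ℤ) → ℂ := fun x u =>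
    conjPow t (f (x + ∑ i, u i)) * conjPow t (expi (l * x / P)) with hT
  set d : ℤ → Fin t → (Fin t → ℤ) → ℂ := fun x i k => b x i k * conjPow t (conj (c x i k)) with hd
  -- The low-rank structure: the box product of the phases equals e(lx/P) on `E`, and solving for
  -- the vertex `k` leaves factors that each miss a coordinate. Their product has modulus 1, so
  -- conjugation inverts it.
  have hphase : ∀ x : ℤ, ∀ k ∈ E, expi (a k * x / P) =
      conjPow t (expi (l * x / P)) * ∏ i, conjPow t (conj (c x i k)) := by
    intro x k hk
    have h1 := hc3 x k
    rw [boxProd_expi, ← mul_div_assoc, ← mul_div_assoc, expi_congr hP (hl k hk)] at h1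
    have h2 : (∏ i, c x i k) * conj (∏ i, c x i k) = 1 := by
      have h3 := congrArg norm h1
      rw [norm_mul, norm_conjPow, norm_expi, norm_expi, one_mul] at h3
      rw [Complex.mul_conj', ← h3]
      simp
    rw [← map_prod, ← map_mul, h1, ← map_prod, mul_assoc, h2, mul_one, conjPow_conjPow]
  have hlow := box_lower_bound_sq H t J T d
    (fun x i k => by
      rw [norm_mul, norm_conjPow, RCLike.norm_conj]
      exact mul_le_one₀ (hb1 _ _ _) (norm_nonneg _) (hc1 _ _ _))
    (fun x i k v => by simp only [hd, hb2, hc2]) hJne hHne hξ (by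
      refine hS.trans ?_
      refine le_trans (le_of_eq (sum_congr rfl fun k hk => ?_))
        (sum_le_sum_of_subset_of_nonneg hE fun _ _ _ => sq_nonneg _)
      congr 2
      refine sum_congr rfl fun x _ => ?_
      rw [hphase x k hk, hb3]
      simp only [hT, hd, prod_mul_distrib]
      ring)
  -- The phase e(lx/P) does not depend on the cube variables, so its box product is 1, as t ≥ 1. The
  -- translation by ∑ h_i is harmless because `J` contains the translated supports.
  have hbox : ∀ h ∈ cube t H, ∀ k ∈ cube t H, ‖∑ x ∈ J, boxProd t (T x) h k‖ ^ 2 =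
      ‖∑ x ∈ J, iterDiff t (k - h) f x‖ ^ 2 := by
    intro h hh k hk
    obtain ⟨r, rfl⟩ : ∃ r, t = r + 1 := ⟨t - 1, by omega⟩
    have h1 : ∑ x ∈ J, boxProd (r + 1) (T x) h k =
        conjPow (r + 1) (∑ x ∈ J, iterDiff (r + 1) (k - h) f (x + ∑ i, h i)) := by
      rw [map_sum]
      refine sum_congr rfl fun x _ => ?_
      simp only [hT]
      rw [boxProd_mul, boxProd_conjPow, boxProd_translate,
        boxProd_const r (by rw [norm_conjPow, norm_expi]), mul_one]
    rw [h1, norm_conjPow]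
    congr 2
    have h3 := abs_le.1 (abs_sum_le_of_mem_cube (hH ▸ hh))
    have h4 := sum_sub_eq_sum (iterDiff (r + 1) (k - h) f) J J (-∑ i, h i) (by
      intro y hy
      have h5 := abs_le.1 (hs y (iterDiff_support f _ _ y hy).1)
      refine ⟨hJ (mem_Icc.2 ?_), hJ (mem_Icc.2 ?_)⟩
      · push_cast at h3 ⊢
        constructor <;> nlinarith
      · push_cast at h3 ⊢
        constructor <;> nlinarith)
    rw [← h4]
    simp only [sub_neg_eq_add]
  rw [sum_congr rfl fun h hh => sum_congr rfl fun k hk => hbox h hh k hk] at hlow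
  have hJW : Icc (-(W : ℤ)) W ⊆ J := by
    refine (Icc_subset_Icc ?_ ?_).trans hJ <;> (push_cast; nlinarith)
  -- For fixed h the map k ↦ k - h is injective, so this is part of the sum defining the Gowers
  -- norm.
  have hinner : ∀ h ∈ cube t H, ∑ k ∈ cube t H, ‖∑ x ∈ J, iterDiff t (k - h) f x‖ ^ 2 ≤
      gowersNorm (t + 1) f ^ (2 ^ (t + 1)) := by
    intro h _
    rw [gowersNorm_succ_pow hs t J hJW]
    have h1 : ∑ k ∈ cube t H, ‖∑ x ∈ J, iterDiff t (k - h) f x‖ ^ 2 =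
        ∑ d ∈ (cube t H).image (fun k => k - h), ‖∑ x ∈ J, iterDiff t d f x‖ ^ 2 := by
      rw [sum_image]
      intro k _ k' _ hkk
      exact sub_left_injective hkk
    rw [h1, ← sum_filter_ne_zero]
    refine sum_le_sum_of_subset_of_nonneg (fun d hd => ?_) fun _ _ _ => sq_nonneg _
    have hne := (mem_filter.1 hd).2
    have h2 : ∑ x ∈ J, iterDiff t d f x ≠ 0 := fun h0 => hne (by simp [h0])
    obtain ⟨x, -, hx⟩ := exists_ne_zero_of_sum_ne_zero h2
    obtain ⟨h4, h5⟩ := iterDiff_support f t d x hx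
    refine mem_cube.2 fun i => ?_
    have h6 := abs_le.1 (hs _ h4)
    have h7 := abs_le.1 (hs _ (h5 i))
    rw [mem_Icc]
    omega
  have hfin := hlow.trans (sum_le_card_nsmul _ _ _ hinner)
  rw [card_cube, nsmul_eq_mul] at hfin
  have hHpos : (0 : ℝ) < (#H : ℝ) ^ t := by
    have : (0 : ℝ) < #H := by exact_mod_cast hHne.card_pos
    positivity
  refine le_of_mul_le_mul_left ?_ hHpos
  push_cast at hfin
  refine le_trans (le_of_eq ?_) hfin
  ring

/-! ### Assembling the argument for large and small N -/

/-- The U² inverse theorem applied to all derivatives of `f` of order `t`. -/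
theorem exists_frequencies {t W P : ℕ} {m δ : ℝ} {N : ℕ} (hN : 1 ≤ N) (hP : 4 * W < P)
    (hW : (2 * W + 1 : ℝ) ≤ m * N) {f : ℤ → ℂ} (hf : ∀ x, ‖f x‖ ≤ 1)
    (hs : ∀ y, f y ≠ 0 → |y| ≤ W) {J : Finset ℤ} (hJ : Icc (-(W : ℤ)) W ⊆ J)
    (hδ : δ * (N : ℝ) ^ (t + 3) ≤ gowersNorm (t + 2) f ^ (2 ^ (t + 2))) :
    ∃ a : (Fin t → ℤ) → ℤ, δ * (N : ℝ) ^ (t + 2) ≤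
      m * ∑ h ∈ cube t (Icc (-(2 * W : ℤ)) (2 * W)),
        ‖∑ x ∈ J, iterDiff t h f x * expi (a h * x / P)‖ ^ 2 := by
  have hNr : (0 : ℝ) < N := by exact_mod_cast hN
  have hsupp : ∀ h : Fin t → ℤ, ∀ y, iterDiff t h f y ≠ 0 → |y| ≤ W :=
    fun h y hy => hs y (iterDiff_support f t h y hy).1
  choose a ha using fun h : Fin t → ℤ => exists_frequency hP (hsupp h)
  refine ⟨a, ?_⟩
  have hcard : (#(Icc (-(W : ℤ)) W) : ℝ) = 2 * W + 1 := by
    rw [Int.card_Icc, show ((W : ℤ) + 1 - -W).toNat = 2 * W + 1 by omega]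
    push_cast
    ring
  have h1 : gowersNorm (t + 2) f ^ (2 ^ (t + 2)) ≤
      ∑ h ∈ cube t (Icc (-(2 * W : ℤ)) (2 * W)),
        ‖∑ x ∈ J, iterDiff t h f x * expi (a h * x / P)‖ ^ 2 * (m * N) := by
    -- Of the t + 1 shifts, the outermost turns the inner sum into an autocorrelation of a
    -- derivative of order t.
    rw [gowersNorm_succ_pow hs (t + 1) _ subset_rfl, sum_cube_succ, sum_comm]
    refine sum_le_sum fun h _ => ?_
    simp only [iterDiff, diffOp, Fin.cons_zero, Fin.tail_cons]
    refine (ha h).trans ?_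
    have h2 : ∑ x ∈ Icc (-(W : ℤ)) W, iterDiff t h f x * expi (a h * x / P) =
        ∑ x ∈ J, iterDiff t h f x * expi (a h * x / P) := by
      refine sum_subset hJ fun x _ hx => ?_
      have h3 : iterDiff t h f x = 0 := by
        by_contra hne
        exact hx (mem_Icc.2 (abs_le.1 (hsupp h x hne)))
      rw [h3, zero_mul]
    rw [h2]
    gcongr
    refine (sum_norm_sq_le_card _ _ fun x => (norm_iterDiff_le hf t h x).trans (hf x)).trans ?_
    rwa [hcard]
  have h2 := hδ.trans h1
  rw [← sum_mul] at h2
  have h3 : N * (δ * (N : ℝ) ^ (t + 2)) ≤ N * (m * ∑ h ∈ cube t (Icc (-(2 * W : ℤ)) (2 * W)),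
      ‖∑ x ∈ J, iterDiff t h f x * expi (a h * x / P)‖ ^ 2) := by
    calc N * (δ * (N : ℝ) ^ (t + 2)) = δ * (N : ℝ) ^ (t + 3) := by ring
      _ ≤ _ := h2
      _ = _ := by ring
  exact le_of_mul_le_mul_left h3 hNr

theorem sum_filter_large {ι : Type*} (S : Finset ι) (v : ι → ℝ) {X τ : ℝ} (h0 : 0 ≤ τ)
    (hX : 2 * X ≤ ∑ h ∈ S, v h) (hτ : #S * τ ≤ X) : X ≤ ∑ h ∈ S with τ ≤ v h, v h := by
  have h1 := sum_filter_add_sum_filter_not S (fun h => τ ≤ v h) v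
  have h2 : ∑ h ∈ S with ¬ τ ≤ v h, v h ≤ #S * τ := by
    refine (sum_le_card_nsmul _ _ τ fun h hh => (not_le.1 (mem_filter.1 hh).2).le).trans ?_
    rw [nsmul_eq_mul]
    gcongr
    exact filter_subset _ _
  linarith

theorem degree_lowering_of_large {t L N V : ℕ} (ht : 1 ≤ t) (hN : 1 ≤ N) (hVL : V + N ≤ L * N)
    {m δ ε ξ η : ℝ} (hm : m = 5 * (2 * t + 1) * L) (hδ : 0 < δ) (hδ1 : δ ≤ 1)
    (hε : ε = δ / (2 * m ^ (t + 1))) (hξ : ξ = δ / (2 * m ^ (t + 3))) (hη : η = ξ ^ (2 ^ t) / 4)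
    {f₀ f₁ : ℤ → ℂ} (hf₀ : ∀ x, ‖f₀ x‖ ≤ 1) (hf₁ : ∀ x, ‖f₁ x‖ ≤ 1)
    (hs₀ : ∀ y, f₀ y ≠ 0 → |y| ≤ V) (hs₁ : ∀ y, f₁ y ≠ 0 → |y| ≤ V)
    (hbig : δ * (N : ℝ) ^ (t + 3) ≤ gowersNorm (t + 2) (dualFun N f₀ f₁) ^ (2 ^ (t + 2)))
    (hlarge : 10 ^ 14 < N * η ^ 10) :
    (ε * η ^ 5 / (3888 * m ^ 3)) ^ (2 ^ t) * (N : ℝ) ^ (t + 2) ≤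
      gowersNorm (t + 1) (dualFun N f₀ f₁) ^ (2 ^ (t + 1)) := by
  classical
  have hNr : (0 : ℝ) < N := by exact_mod_cast hN
  have hL : 1 ≤ L := by
    by_contra hcon
    have : L = 0 := by omega
    rw [this, zero_mul] at hVL
    omega
  set F := dualFun N f₀ f₁ with hF
  set W := L * N with hW
  set A := (2 * t + 1) * W with hA
  have hNW : N ≤ W := Nat.le_mul_of_pos_left N hL
  have hWA : W ≤ A := Nat.le_mul_of_pos_left W (by omega)
  have hVW : V ≤ W := by omega
  have hLr : (1 : ℝ) ≤ L := by exact_mod_cast hL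
  have hmN : m * N = 5 * A := by
    rw [hm, hA, hW]
    push_cast
    ring
  have hNA : (N : ℝ) ≤ A := by exact_mod_cast hNW.trans hWA
  have hWAr : (W : ℝ) ≤ A := by exact_mod_cast hWA
  have hNWr : (N : ℝ) ≤ W := by exact_mod_cast hNW
  have hN1r : (1 : ℝ) ≤ N := by exact_mod_cast hN
  have hm1 : 1 ≤ m := by
    rw [hm]
    have : (0 : ℝ) ≤ t := Nat.cast_nonneg t
    nlinarith
  have hm0 : 0 < m := by linarith
  -- The modulus is P = 5A = mN: large enough to avoid wraparound, yet comparable to N, so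
  -- frequencies O(1/N) correspond to few residues.
  have hP : 4 * A < 5 * A := by omega
  have hFle : ∀ x, ‖F x‖ ≤ 1 := norm_dualFun_le hN hf₀ hf₁
  have hFs : ∀ y, F y ≠ 0 → |y| ≤ W := fun y hy => by
    have h1 := dualFun_support hs₀ y hy
    have h2 : (V + N : ℤ) ≤ W := by exact_mod_cast hVL
    exact h1.trans h2
  set H : Finset ℤ := Icc (-(2 * W : ℤ)) (2 * W) with hH
  set J : Finset ℤ := Icc (-(2 * A : ℤ)) (2 * A) with hJ
  have hHcard : (#H : ℝ) = 4 * W + 1 := by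
    rw [hH, Int.card_Icc, show (2 * (W : ℤ) + 1 - -(2 * W)).toNat = 4 * W + 1 by omega]
    push_cast
    ring
  have hJcard : (#J : ℝ) = 4 * A + 1 := by
    rw [hJ, Int.card_Icc, show (2 * (A : ℤ) + 1 - -(2 * A)).toNat = 4 * A + 1 by omega]
    push_cast
    ring
  have hHm : (#H : ℝ) ≤ m * N := by rw [hHcard, hmN]; linarith
  have hJm : (#J : ℝ) ≤ m * N := by rw [hJcard, hmN]; linarith
  have hNH : (N : ℝ) ≤ #H := by rw [hHcard]; linarith
  have hNJ : (N : ℝ) ≤ #J := by rw [hJcard]; linarith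
  have hHne : H.Nonempty := ⟨0, by rw [hH, mem_Icc]; omega⟩
  obtain ⟨a, ha⟩ := exists_frequencies (J := J) (P := 5 * A) (m := m) hN (by omega)
    (by rw [hmN]; linarith) hFle hFs (Icc_subset_Icc (by omega) (by omega)) hbig
  set S : (Fin t → ℤ) → ℝ := fun h => ‖∑ x ∈ J, iterDiff t h F x *
    expi (a h * x / (5 * A : ℕ))‖ ^ 2 with hS
  have hε0 : 0 < ε := by rw [hε]; positivity
  have hξ0 : 0 < ξ := by rw [hξ]; positivity
  have hξ1 : ξ ≤ 1 := by
    rw [hξ, div_le_one (by positivity)]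
    have := one_le_pow₀ hm1 (n := t + 3)
    linarith
  have hη0 : 0 < η := by rw [hη]; positivity
  have hη1 : η ≤ 1 := by
    rw [hη]
    have := pow_le_one₀ hξ0.le hξ1 (n := 2 ^ t)
    linarith
  -- The value of ε makes the h outside `E` contribute at most half of the total. Individual
  -- largeness on `E` is what later survives passing to the subset `E'`.
  set E := (cube t H).filter fun h => ε * (N : ℝ) ^ 2 ≤ S h with hE
  have hEsum : δ * (N : ℝ) ^ (t + 2) / (2 * m) ≤ ∑ h ∈ E, S h := by
    refine sum_filter_large _ _ (by positivity) ?_ ?_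
    · rw [show 2 * (δ * (N : ℝ) ^ (t + 2) / (2 * m)) = δ * (N : ℝ) ^ (t + 2) / m by
        field_simp, div_le_iff₀ hm0]
      exact ha.trans (mul_comm _ _).le
    · rw [card_cube]
      push_cast
      calc (#H : ℝ) ^ t * (ε * (N : ℝ) ^ 2) ≤ (m * N) ^ t * (ε * (N : ℝ) ^ 2) := by gcongr
        _ = δ * (N : ℝ) ^ (t + 2) / (2 * m) := by
          rw [hε, mul_pow]
          field_simp
          ring
  have hcount := card_small_altSum (P := 5 * A) hN hNW hP hH (J := J) rfl
    hf₀ hf₁ (fun y hy => (hs₀ y hy).trans (by exact_mod_cast hVW))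
    (fun y hy => (hs₁ y hy).trans (by exact_mod_cast hVW)) a (filter_subset _ _ : E ⊆ _) hξ0 hξ1
    hη hlarge (by
      refine le_trans ?_ hEsum
      calc ξ * ((#J : ℝ) ^ 2 * (#H : ℝ) ^ t) ≤ ξ * ((m * N) ^ 2 * (m * N) ^ t) := by gcongr
        _ = δ * (N : ℝ) ^ (t + 2) / (2 * m) := by
          rw [hξ, mul_pow, mul_pow]
          field_simp
          ring)
  -- The bound |l| N η⁴ ≤ 2592 P with P = mN reads |l| ≤ q. As q ≥ 1, the number of residues is at
  -- most 3q, whence 3888 = 3 · 2592 / 2.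
  set q : ℝ := 2592 * m / η ^ 4 with hq
  have hq1 : 1 ≤ q := by
    rw [hq, le_div_iff₀ (by positivity)]
    have := pow_le_one₀ hη0.le hη1 (n := 4)
    linarith
  have hQle : (⌊q⌋₊ : ℝ) ≤ q := Nat.floor_le (by linarith)
  obtain ⟨h₀, l, E', hE'E, hE'l, hE'card⟩ := exists_common_altSum (P := 5 * A) (Q := ⌊q⌋₊) hHne a
    (filter_subset _ _) (fun z hz => by
      obtain ⟨-, h1, l, h2, h3⟩ := mem_filter.1 hz
      refine ⟨h1, l, h2, ?_⟩
      have h4 : ((5 * A : ℕ) : ℝ) = m * N := by rw [hmN]; push_cast; ring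
      rw [h4] at h3
      have h5 : |(l : ℝ)| ≤ q := by
        rw [hq, le_div_iff₀ (by positivity)]
        refine le_of_mul_le_mul_right ?_ hNr
        linarith
      have h6 : (l.natAbs : ℝ) ≤ q := by rwa [Nat.cast_natAbs, Int.cast_abs]
      rw [Int.abs_eq_natAbs]
      exact_mod_cast Nat.le_floor h6) hcount
  have hE'sum : ε * η ^ 5 / (3888 * m ^ 3) * ((#J : ℝ) ^ 2 * (#H : ℝ) ^ t) ≤ ∑ h ∈ E', S h := by
    have h1 : #E' * (ε * (N : ℝ) ^ 2) ≤ ∑ h ∈ E', S h := by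
      rw [← nsmul_eq_mul]
      exact card_nsmul_le_sum _ _ _ fun h hh => (mem_filter.1 (hE'E hh)).2
    refine le_trans ?_ h1
    have h2 : 2 * η / (3 * q) ≤ 2 * η / (2 * ⌊q⌋₊ + 1) := by
      gcongr
      linarith
    calc ε * η ^ 5 / (3888 * m ^ 3) * ((#J : ℝ) ^ 2 * (#H : ℝ) ^ t)
        ≤ ε * η ^ 5 / (3888 * m ^ 3) * ((m * N) ^ 2 * (#H : ℝ) ^ t) := by gcongr
      _ = 2 * η / (3 * q) * (#H : ℝ) ^ t * (ε * (N : ℝ) ^ 2) := by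
        rw [hq]
        field_simp
        norm_num
      _ ≤ 2 * η / (2 * ⌊q⌋₊ + 1) * (#H : ℝ) ^ t * (ε * (N : ℝ) ^ 2) := by gcongr
      _ ≤ #E' * (ε * (N : ℝ) ^ 2) := by gcongr
  have hfin := gowersNorm_lower_bound (P := 5 * A) ht (by omega) hH
    (J := J) (Icc_subset_Icc (by omega) (by omega)) hFle hFs a
    (hE'E.trans (filter_subset _ _)) h₀ l hE'l (by positivity) hE'sum
  refine le_trans ?_ hfin
  calc _ = (ε * η ^ 5 / (3888 * m ^ 3)) ^ (2 ^ t) * ((N : ℝ) ^ 2 * (N : ℝ) ^ t) := by ring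
    _ ≤ _ := by gcongr

/-- If μ = max |f|, the trivial upper bound for the large norm forces μ² ≥ δ/m^{t+3}. The term h = 0
of the smaller norm is a square of a sum of nonnegative powers of |f|, hence at least μ^{2^{t+1}}.
-/
theorem gowersNorm_lower_bound_of_small {t W N : ℕ} {m δ : ℝ} (ht : 1 ≤ t) (hN : 1 ≤ N)
    (hm : (4 * W + 1 : ℝ) ≤ m * N) {f : ℤ → ℂ} (hf : ∀ x, ‖f x‖ ≤ 1)
    (hs : ∀ y, f y ≠ 0 → |y| ≤ W) (hδ0 : 0 ≤ δ)
    (hδ : δ * (N : ℝ) ^ (t + 3) ≤ gowersNorm (t + 2) f ^ (2 ^ (t + 2))) :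
    (δ / m ^ (t + 3)) ^ (2 ^ t) ≤ gowersNorm (t + 1) f ^ (2 ^ (t + 1)) := by
  have hNr : (0 : ℝ) < N := by exact_mod_cast hN
  have hm0 : 0 < m := by
    by_contra hcon
    have : m * N ≤ 0 := mul_nonpos_of_nonpos_of_nonneg (not_lt.1 hcon) hNr.le
    have : (0 : ℝ) ≤ W := Nat.cast_nonneg W
    linarith
  set I : Finset ℤ := Icc (-(W : ℤ)) W with hI
  have hIcard : (#I : ℝ) ≤ m * N := by
    rw [hI, Int.card_Icc, show ((W : ℤ) + 1 - -W).toNat = 2 * W + 1 by omega]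
    push_cast
    have : (0 : ℝ) ≤ W := Nat.cast_nonneg W
    linarith
  obtain ⟨x₀, hx₀, hmax⟩ := exists_max_image I (fun x => ‖f x‖) ⟨0, by rw [hI, mem_Icc]; omega⟩
  set μ := ‖f x₀‖ with hμ
  rw [gowersNorm_succ_pow hs (t + 1) I subset_rfl] at hδ
  have h1 : ∀ h ∈ cube (t + 1) (Icc (-(2 * W : ℤ)) (2 * W)),
      ‖∑ x ∈ I, iterDiff (t + 1) h f x‖ ^ 2 ≤ (m * N * μ) ^ 2 := by
    intro h _
    gcongr
    refine (norm_sum_le _ _).trans ((sum_le_card_nsmul _ _ μ fun x hx =>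
      (norm_iterDiff_le hf _ h x).trans (hmax x hx)).trans ?_)
    rw [nsmul_eq_mul]
    gcongr
  have h2 := hδ.trans (sum_le_card_nsmul _ _ _ h1)
  have h3 : (#(Icc (-(2 * W : ℤ)) (2 * W)) : ℝ) ≤ m * N := by
    rw [Int.card_Icc, show (2 * (W : ℤ) + 1 - -(2 * W)).toNat = 4 * W + 1 by omega]
    push_cast
    linarith
  rw [card_cube, nsmul_eq_mul, Nat.cast_pow] at h2
  have h4 : (N : ℝ) ^ (t + 3) * δ ≤ (N : ℝ) ^ (t + 3) * (m ^ (t + 3) * μ ^ 2) := by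
    calc (N : ℝ) ^ (t + 3) * δ = δ * (N : ℝ) ^ (t + 3) := by ring
      _ ≤ _ := h2
      _ ≤ (m * N) ^ (t + 1) * (m * N * μ) ^ 2 := by gcongr
      _ = _ := by rw [mul_pow]; ring
  have h5 := le_of_mul_le_mul_left h4 (by positivity)
  have h6 : δ / m ^ (t + 3) ≤ μ ^ 2 := by
    rw [div_le_iff₀ (by positivity)]
    linarith
  rw [gowersNorm_succ_pow hs t I subset_rfl]
  obtain ⟨r, rfl⟩ : ∃ r, t = r + 1 := ⟨t - 1, by omega⟩
  have h7 : ‖∑ x ∈ I, iterDiff (r + 1) 0 f x‖ ^ 2 ≤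
      ∑ h ∈ cube (r + 1) (Icc (-(2 * W : ℤ)) (2 * W)), ‖∑ x ∈ I, iterDiff (r + 1) h f x‖ ^ 2 :=
    single_le_sum (f := fun h => ‖∑ x ∈ I, iterDiff (r + 1) h f x‖ ^ 2)
      (fun _ _ => sq_nonneg _) (mem_cube.2 fun i => by simp)
  refine le_trans ?_ h7
  have h8 : ‖∑ x ∈ I, iterDiff (r + 1) 0 f x‖ = ∑ x ∈ I, ‖f x‖ ^ (2 ^ (r + 1)) := by
    simp_rw [iterDiff_zero_eq_norm]
    rw [← Complex.ofReal_sum, Complex.norm_real, Real.norm_of_nonneg]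
    exact sum_nonneg fun _ _ => by positivity
  rw [h8]
  have h9 : μ ^ (2 ^ (r + 1)) ≤ ∑ x ∈ I, ‖f x‖ ^ (2 ^ (r + 1)) :=
    single_le_sum (f := fun x => ‖f x‖ ^ (2 ^ (r + 1))) (fun _ _ => by positivity) hx₀
  calc (δ / m ^ (r + 1 + 3)) ^ (2 ^ (r + 1)) ≤ (μ ^ 2) ^ (2 ^ (r + 1)) := by gcongr
    _ = (μ ^ (2 ^ (r + 1))) ^ 2 := by rw [← pow_mul, ← pow_mul, mul_comm]
    _ ≤ _ := by gcongr

/-- Degree lowering with no lower bound on `N`: for `N` bounded by a power of `δ⁻¹` the conclusion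
follows from the diagonal terms of the Gowers norm alone. -/
theorem degree_lowering {t L : ℕ} (ht : 1 ≤ t) (hL : 1 ≤ L) :
    ∃ (c : ℝ) (B : ℕ), 0 < c ∧ 0 < B ∧ ∀ (N V : ℕ) (δ : ℝ) (f₀ f₁ : ℤ → ℂ), 1 ≤ N →
      V + N ≤ L * N → 0 < δ → δ ≤ 1 → (∀ x, ‖f₀ x‖ ≤ 1) → (∀ x, ‖f₁ x‖ ≤ 1) →
      (∀ y, f₀ y ≠ 0 → |y| ≤ V) → (∀ y, f₁ y ≠ 0 → |y| ≤ V) →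
      δ * (N : ℝ) ^ (t + 3) ≤ gowersNorm (t + 2) (dualFun N f₀ f₁) ^ (2 ^ (t + 2)) →
      c * δ ^ B * (N : ℝ) ^ (t + 2) ≤
        gowersNorm (t + 1) (dualFun N f₀ f₁) ^ (2 ^ (t + 1)) := by
  obtain ⟨m, hm⟩ : ∃ m : ℝ, m = 5 * (2 * t + 1) * L := ⟨_, rfl⟩
  set p := 2 ^ t with hp
  have hLr : (1 : ℝ) ≤ L := by exact_mod_cast hL
  have hm0 : 0 < m := by rw [hm]; positivity
  set c₁ : ℝ := (1 / (2 * m ^ (t + 3))) ^ p / 4 with hc₁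
  have hc₁0 : 0 < c₁ := by positivity
  -- With η = c₁ δ^p, the condition 10¹⁴ < N η¹⁰ becomes C < N δ^{10p}, the case distinction below.
  set C : ℝ := 10 ^ 14 / c₁ ^ 10 with hC
  have hC0 : 0 < C := by positivity
  set c₂ : ℝ := (1 / (2 * m ^ (t + 1)) * c₁ ^ 5 / (3888 * m ^ 3)) ^ p with hc₂
  set c₃ : ℝ := (1 / m ^ (t + 3)) ^ p / C ^ (t + 2) with hc₃
  -- The exponent is the sum of those for large and small N. In the small case, δ^{10p(t+2)} absorbs
  -- N^{t+2}.
  refine ⟨min c₂ c₃, (5 * p + 1) * p + (p + 10 * p * (t + 2)), by positivity, by positivity, ?_⟩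
  intro N V δ f₀ f₁ hN hVL hδ hδ1 hf₀ hf₁ hs₀ hs₁ hbig
  have hNr : (0 : ℝ) < N := by exact_mod_cast hN
  rcases lt_or_ge C (N * δ ^ (10 * p)) with hlarge | hsmall
  · have hη : (δ / (2 * m ^ (t + 3))) ^ (2 ^ t) / 4 = c₁ * δ ^ p := by
      rw [hc₁, ← hp, div_pow, div_pow, one_pow]
      ring
    have h1 := degree_lowering_of_large ht hN hVL hm hδ hδ1 rfl rfl rfl hf₀ hf₁ hs₀ hs₁ hbig (by
      rw [hη, mul_pow, ← pow_mul, mul_comm p 10]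
      rw [hC, div_lt_iff₀ (by positivity)] at hlarge
      linarith)
    refine le_trans ?_ h1
    rw [hη]
    have h2 : (δ / (2 * m ^ (t + 1)) * (c₁ * δ ^ p) ^ 5 / (3888 * m ^ 3)) ^ (2 ^ t) =
        c₂ * δ ^ ((5 * p + 1) * p) := by
      rw [hc₂, pow_mul δ, ← mul_pow, ← hp]
      congr 1
      rw [mul_pow, ← pow_mul, pow_succ δ, mul_comm p 5]
      ring
    rw [h2]
    have h3 : δ ^ ((5 * p + 1) * p + (p + 10 * p * (t + 2))) ≤ δ ^ ((5 * p + 1) * p) :=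
      pow_le_pow_of_le_one hδ.le hδ1 (Nat.le_add_right _ _)
    gcongr
    exact min_le_left _ _
  · have hW : (4 * (L * N : ℕ) + 1 : ℝ) ≤ m * N := by
      have h1 : (1 : ℝ) ≤ N := by exact_mod_cast hN
      have h2 : (0 : ℝ) ≤ t := Nat.cast_nonneg t
      have h3 : (1 : ℝ) ≤ L * N := by nlinarith
      rw [hm]
      push_cast
      nlinarith
    have h1 := gowersNorm_lower_bound_of_small (W := L * N) ht hN hW
      (norm_dualFun_le hN hf₀ hf₁) (fun y hy => (dualFun_support hs₀ y hy).trans (by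
        exact_mod_cast hVL)) hδ.le hbig
    refine le_trans ?_ h1
    have h2 : (N * δ ^ (10 * p)) ^ (t + 2) ≤ C ^ (t + 2) := by gcongr
    have h3 : δ ^ ((5 * p + 1) * p + (p + 10 * p * (t + 2))) ≤ δ ^ (p + 10 * p * (t + 2)) :=
      pow_le_pow_of_le_one hδ.le hδ1 (Nat.le_add_left _ _)
    calc min c₂ c₃ * δ ^ ((5 * p + 1) * p + (p + 10 * p * (t + 2))) * (N : ℝ) ^ (t + 2)
        ≤ c₃ * δ ^ (p + 10 * p * (t + 2)) * (N : ℝ) ^ (t + 2) := by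
          gcongr
          exact min_le_right _ _
      _ = (δ / m ^ (t + 3)) ^ p * ((N * δ ^ (10 * p)) ^ (t + 2) / C ^ (t + 2)) := by
          rw [hc₃, mul_pow, ← pow_mul, pow_add, div_pow, div_pow, one_pow]
          ring
      _ ≤ (δ / m ^ (t + 3)) ^ p * 1 := by
          gcongr
          exact div_le_one_of_le₀ h2 (by positivity)
      _ = _ := by rw [mul_one]

end DegreeLowering

theorem theorem4p7 (K : ℝ) (hK : 1 ≤ K) :
    ∃ C A : ℝ, 0 < C ∧ 0 < A ∧
      ∀ s : ℕ, 3 ≤ s →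
        ∃ c B : ℝ, 0 < c ∧ 0 < B ∧
          ∀ (N : ℕ) (N₀ δ : ℝ) (f₀ f₁ : ℤ → ℂ),
            1 ≤ N → 0 < δ → δ ≤ 1 →
            (N : ℝ) / K ≤ N₀ → N₀ ≤ K * N →
            (∀ x, ‖f₀ x‖ ≤ 1) → (∀ x, ‖f₁ x‖ ≤ 1) →
            Function.support f₀ ⊆ Set.Icc (-⌊N₀⌋) ⌊N₀⌋ →
            Function.support f₁ ⊆ Set.Icc (-⌊N₀⌋) ⌊N₀⌋ →
            δ * (N : ℝ) ^ (s + 1) ≤ gowersNorm s (dualFun N f₀ f₁) ^ (2 ^ s) →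
            (N : ℝ) ≤ C * δ ^ (-A) ∨
              c * δ ^ B * (N : ℝ) ^ s ≤ gowersNorm (s - 1) (dualFun N f₀ f₁) ^ (2 ^ (s - 1)) := by
  -- These two constants are arbitrary: the second alternative is established for every N.
  refine ⟨1, 1, one_pos, one_pos, fun s hs => ?_⟩
  obtain ⟨t, ht, rfl⟩ : ∃ t, 1 ≤ t ∧ s = t + 2 := ⟨s - 2, by omega, by omega⟩
  -- ⌈K⌉ covers the supports of f₀ and f₁, and the extra 1 the shift by n ≤ N in the dual function.
  obtain ⟨c, B, hc, hB, h⟩ := DegreeLowering.degree_lowering (L := ⌈K⌉₊ + 1) ht (by omega)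
  refine ⟨c, B, hc, by exact_mod_cast hB, ?_⟩
  intro N N₀ δ f₀ f₁ hN hδ hδ1 _ hN₀ hf₀ hf₁ hs₀ hs₁ hbig
  right
  have hfloor : ⌊N₀⌋ ≤ ((⌈K⌉₊ * N : ℕ) : ℤ) := by
    have h1 : (⌊N₀⌋ : ℝ) ≤ ⌈K⌉₊ * N :=
      (Int.floor_le N₀).trans (hN₀.trans (by gcongr; exact Nat.le_ceil K))
    exact_mod_cast h1
  have hsupp : ∀ f : ℤ → ℂ, Function.support f ⊆ Set.Icc (-⌊N₀⌋) ⌊N₀⌋ → ∀ y, f y ≠ 0 →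
      |y| ≤ ((⌈K⌉₊ * N : ℕ) : ℤ) :=
    fun f hf y hy => (abs_le.2 (hf hy)).trans hfloor
  rw [Real.rpow_natCast]
  exact h N (⌈K⌉₊ * N) δ f₀ f₁ hN (by rw [add_mul, one_mul]) hδ hδ1 hf₀ hf₁ (hsupp f₀ hs₀)
    (hsupp f₁ hs₁) hbig
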